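/- Consider the system $$u_t = 2uv,\qquad v_t = H(u^2),\qquad u(0)=u_0,\quad v(0)=v_0, \tag{1}$$ for real functions that are $2\pi$-periodic in $x\in\mathbb R$, where $H$ is the periodic Hilbert transform $$(Hf)(x)=\frac1{2\pi}\,\mathrm{P.V.}\!\int_0^{2\pi} f(y)\cot\Big(\frac{x-y}{2}\Big)\,dy .$$ Let $H^1$ be the Sobolev space of $2\pi$-periodic functions, $\|f\|_{H^1}^2=\|f\|_{L^2(0,2\pi)}^2+\|f_x\|_{L^2(0,2\pi)}^2$. A solution of (1) on $[0,T)$ is a pair $u,v\in C^1([0,T);H^1)$ satisfying (1). **Theorem.** Let $a<b$ with $(a,b)\subset(0,2\pi)$ and $b-a<\pi$. Let $u_0,v_0\in H^1$, and suppose that the support of $u_0$, within the period $(0,2\pi)$, is contained in $(a,b)$. Let $\phi$ be a $2\pi$-periodic Lipschitz continuous function with $\phi(x)=x-a$ on $[a,b]$, and put $$C=4\int_a^b\phi\,u_0^2\,v_0\,dx,\qquad I_\infty=\int_0^{\infty}\frac{dy}{\sqrt{y^3+1}} .$$ If $C>0$, then the solution of (1) develops a singularity in the $H^1$ norm no later than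 $$T^*=\left(\frac{4C\cos\left(\frac{b-a}{2}\right)}{3\pi(b-a)^2}\right)^{-1/3} I_\infty ,$$ that is: there are $T\in(0,T^*]$ and a solution $(u,v)$ of (1) on $[0,T)$ with $\|u(t)\|_{H^1}+\|v(t)\|_{H^1}\to\infty$ as $t\uparrow T$, and every solution of (1) on an interval $[0,T')$, $T'>0$, satisfies $T'\le T$ and coincides with $(u,v)$ on $[0,T')$. -/

import Mathlib

open MeasureTheory Set Filter Topology
open scoped ContDiff

namespace NonlocalSystem

instance factTwoPiPos : Fact (0 < 2 * Real.pi) := ⟨Real.two_pi_pos⟩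

/-- Real square-integrable functions on the circle `ℝ / 2πℤ` (with measure of total mass `2π`). -/
abbrev L2Circle : Type := Lp ℝ 2 (volume : Measure (AddCircle (2 * Real.pi)))

/-- The `2π`-periodic function on `ℝ` represented by a function in `L²(ℝ / 2πℤ)`. -/
noncomputable def L2Circle.fn (f : L2Circle) (x : ℝ) : ℝ := f (x : AddCircle (2 * Real.pi))

theorem L2Circle.fn_ae (f : L2Circle) (h : AddCircle (2 * Real.pi) → ℝ) (hfg : f =ᵐ[volume] h) :
    f.fn =ᵐ[volume.restrict (Ioc 0 (2 * Real.pi))] fun x => h (x : AddCircle (2 * Real.pi)) := by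
  have mp := AddCircle.measurePreserving_mk (2 * Real.pi) 0
  rw [zero_add] at mp
  exact mp.quasiMeasurePreserving.ae_eq_comp hfg

theorem L2Circle.fn_integrable (f : L2Circle) (ψ : ℝ → ℝ) (hψ : Continuous ψ) :
    IntervalIntegrable (fun x => f.fn x * ψ x) volume 0 (2 * Real.pi) := by
  have mp := AddCircle.measurePreserving_mk (2 * Real.pi) 0
  rw [zero_add] at mp
  have h1 : MemLp f.fn 2 (volume.restrict (Ioc 0 (2 * Real.pi))) :=
    (Lp.memLp f).comp_measurePreserving mp
  have h2 : IntervalIntegrable f.fn volume 0 (2 * Real.pi) := by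
    rw [intervalIntegrable_iff_integrableOn_Ioc_of_le Real.two_pi_pos.le]
    exact h1.integrable (by norm_num)
  exact h2.mul_continuousOn hψ.continuousOn

/-- `g` is the weak (distributional) derivative of `f` on the circle: the integration by parts
formula holds against every smooth `2π`-periodic test function. -/
def IsWeakDeriv (f g : L2Circle) : Prop :=
  ∀ ψ : ℝ → ℝ, ContDiff ℝ ∞ ψ → Function.Periodic ψ (2 * Real.pi) →
    ∫ x in (0 : ℝ)..(2 * Real.pi), f.fn x * deriv ψ x
      = -∫ x in (0 : ℝ)..(2 * Real.pi), g.fn x * ψ x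

theorem L2Circle.integral_add (f g : L2Circle) (ψ : ℝ → ℝ) (hψ : Continuous ψ) :
    ∫ x in (0 : ℝ)..(2 * Real.pi), (f + g).fn x * ψ x
      = (∫ x in (0 : ℝ)..(2 * Real.pi), f.fn x * ψ x)
        + ∫ x in (0 : ℝ)..(2 * Real.pi), g.fn x * ψ x := by
  rw [← intervalIntegral.integral_add (f.fn_integrable ψ hψ) (g.fn_integrable ψ hψ)]
  apply intervalIntegral.integral_congr_ae_restrict
  rw [uIoc_of_le Real.two_pi_pos.le]
  filter_upwards [L2Circle.fn_ae (f + g) _ (Lp.coeFn_add f g)] with x hx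
  rw [hx]
  simp only [Pi.add_apply, L2Circle.fn]
  ring

theorem L2Circle.integral_smul (c : ℝ) (f : L2Circle) (ψ : ℝ → ℝ) :
    ∫ x in (0 : ℝ)..(2 * Real.pi), (c • f).fn x * ψ x
      = c * ∫ x in (0 : ℝ)..(2 * Real.pi), f.fn x * ψ x := by
  rw [← intervalIntegral.integral_const_mul]
  apply intervalIntegral.integral_congr_ae_restrict
  rw [uIoc_of_le Real.two_pi_pos.le]
  filter_upwards [L2Circle.fn_ae (c • f) _ (Lp.coeFn_smul c f)] with x hx
  rw [hx]
  simp only [Pi.smul_apply, L2Circle.fn, smul_eq_mul]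
  ring

/-- The pairs `(f, f')` of an `L²` function on the circle and its `L²` weak derivative, inside the
Hilbert sum `L² ⊕ L²`. -/
def h1Submodule : Submodule ℝ (WithLp 2 (L2Circle × L2Circle)) where
  carrier := {p | IsWeakDeriv p.fst p.snd}
  zero_mem' := by
    intro ψ _ _
    have h : ∀ χ : ℝ → ℝ, ∫ x in (0 : ℝ)..(2 * Real.pi), (0 : L2Circle).fn x * χ x = 0 := by
      intro χ
      have := L2Circle.integral_smul 0 0 χ
      simpa using this
    change ∫ x in (0 : ℝ)..(2 * Real.pi), (0 : L2Circle).fn x * deriv ψ x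
      = -∫ x in (0 : ℝ)..(2 * Real.pi), (0 : L2Circle).fn x * ψ x
    rw [h, h, neg_zero]
  add_mem' := by
    intro p q hp hq ψ h1 h2
    have h3 : Continuous (deriv ψ) := h1.continuous_deriv (by simp)
    change ∫ x in (0 : ℝ)..(2 * Real.pi), (p.fst + q.fst).fn x * deriv ψ x
      = -∫ x in (0 : ℝ)..(2 * Real.pi), (p.snd + q.snd).fn x * ψ x
    rw [L2Circle.integral_add _ _ _ h3, L2Circle.integral_add _ _ _ h1.continuous,
      hp ψ h1 h2, hq ψ h1 h2, neg_add]
  smul_mem' := by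
    intro c p hp ψ h1 h2
    change ∫ x in (0 : ℝ)..(2 * Real.pi), (c • p.fst).fn x * deriv ψ x
      = -∫ x in (0 : ℝ)..(2 * Real.pi), (c • p.snd).fn x * ψ x
    rw [L2Circle.integral_smul, L2Circle.integral_smul, hp ψ h1 h2, mul_neg]

/-- The Sobolev space `H¹` of `2π`-periodic real functions, with the norm
`‖f‖² = ‖f‖²_{L²(0,2π)} + ‖f'‖²_{L²(0,2π)}` inherited from `L² ⊕ L²`. An element is stored as
`(f, f')`; the second component is determined by the first. -/
abbrev H1 : Type := ↥h1Submodule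

/-- The `2π`-periodic function on `ℝ` (defined up to a null set) given by an element of `H¹`. -/
noncomputable def H1.fn (u : H1) : ℝ → ℝ := (u : WithLp 2 (L2Circle × L2Circle)).fst.fn

/-- The truncated periodic Hilbert transform: the part of the integral over one period where the
distance from `y` to `x` modulo `2π` exceeds `ε`. -/
noncomputable def truncHilbert (f : ℝ → ℝ) (ε x : ℝ) : ℝ :=
  1 / (2 * Real.pi) *
    ∫ y in {y : ℝ | y ∈ Ioc 0 (2 * Real.pi) ∧ ε < ‖((x - y : ℝ) : AddCircle (2 * Real.pi))‖},
      f y * Real.cot ((x - y) / 2)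

/-- `h = H f` almost everywhere, `H` being the periodic Hilbert transform
`H f (x) = (1 / 2π) P.V. ∫₀^{2π} f(y) cot((x - y) / 2) dy`; the existence of the principal value is
part of the assertion. -/
def IsHilbertTransform (f h : ℝ → ℝ) : Prop :=
  ∀ᵐ x : ℝ, Tendsto (fun ε => truncHilbert f ε x) (𝓝[>] 0) (𝓝 (h x))

/-- `(u, v)`, of class `C¹([0,T); H¹)`, solves `u_t = 2uv`, `v_t = H(u²)` on `[0,T)` with initial
data `(u₀, v₀)`. Time derivatives are taken in `H¹`, one-sided at `t = 0`. -/
structure IsSolution (u₀ v₀ : H1) (T : ℝ) (u v : ℝ → H1) : Prop where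
  contDiffOn_u : ContDiffOn ℝ 1 u (Ico 0 T)
  contDiffOn_v : ContDiffOn ℝ 1 v (Ico 0 T)
  init_u : u 0 = u₀
  init_v : v 0 = v₀
  eq_u : ∀ t ∈ Ico 0 T, ∀ᵐ x : ℝ,
    (derivWithin u (Ico 0 T) t).fn x = 2 * (u t).fn x * (v t).fn x
  eq_v : ∀ t ∈ Ico 0 T,
    IsHilbertTransform (fun x => (u t).fn x ^ 2) (derivWithin v (Ico 0 T) t).fn

end NonlocalSystem

namespace NonlocalSystem

/-! ### Functions on the circle as periodic functions on the line -/

/-! Write F = u² and let m(t) be the integral of (x - a) F over [a, b]. The equations give m' = 4∫(x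
- a) F v, so m'(0) = C, and m'' = 4∫(x - a) F H(F) + 16∫(x - a) F v². The last integral is
nonnegative. At a fixed x, the equation u_t = 2uv is a linear scalar ODE in t, so u stays zero
wherever u₀ is zero, and F remains supported in (a, b).

The heart of the matter is a lower bound for ∫(x - a) F H(F) (`H1.integral_moment_hilbertEval_ge`).
Folding the principal value at x turns it into the integral over (0, π) of (F(x - s) - F(x + s))
cot(s/2). Integrating first in x against (x - a) F(x), and translating one term, leaves s cot(s/2)
A(s), where A is the autocorrelation of F. On the support of A one has s ≤ b - a, hence s cot(s/2) ≥
2 cos((b - a)/2), while A has integral (∫F)²/2 over the half line. Since m ≤ (b - a)∫F, this yields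
m'' ≥ k m² with k = 2 cos((b - a)/2) / (π (b - a)²).

With m(0) ≥ 0 and m'(0) = C > 0, the energy (m')² - (2k/3) m³ is nondecreasing, and a quadrature
bounds the lifespan by (2kC/3)^(-1/3) I_∞ (`time_le_of_second_order_inequality`), which is T*.

Existence, uniqueness and the blow-up alternative come from Picard–Lindelöf in H¹ × H¹
(`exists_maximal_isFlowLine`): H¹ is complete, closed under products, and H is bounded on it, so the
vector field is locally Lipschitz. The tool for these facts is the real trigonometric system `cas
n`, whose span is dense in H¹: identities between continuous linear or bilinear maps need checking
only there. In particular `rep_hilbertL` identifies the bounded operator `hilbertL`, defined on this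
system, with the pointwise principal value. -/

theorem quasiMeasurePreserving_coe :
    Measure.QuasiMeasurePreserving ((↑) : ℝ → AddCircle (2 * Real.pi)) volume volume := by
  refine ⟨AddCircle.measurable_mk', ?_⟩
  refine Measure.AbsolutelyContinuous.mk fun s hs h0 => ?_
  rw [Measure.map_apply AddCircle.measurable_mk' hs]
  -- Countably many periods cover the line, and the projection preserves measure on each of them.
  have hU : (⋃ n : ℤ, Ioc (n • (2 * Real.pi)) ((n + 1) • (2 * Real.pi))) = univ :=
    iUnion_Ioc_zsmul Real.two_pi_pos
  rw [← inter_univ (((↑) : ℝ → AddCircle (2 * Real.pi)) ⁻¹' s), ← hU, inter_iUnion]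
  refine measure_iUnion_null fun n => ?_
  have mp := AddCircle.measurePreserving_mk (2 * Real.pi) (n • (2 * Real.pi))
  have h := mp.measure_preimage hs.nullMeasurableSet
  rw [h0, Measure.restrict_apply (AddCircle.measurable_mk' hs)] at h
  rwa [add_smul, one_smul]

theorem L2Circle.fn_ae_real (f : L2Circle) (h : AddCircle (2 * Real.pi) → ℝ)
    (hfg : f =ᵐ[volume] h) : f.fn =ᵐ[volume] fun x => h (x : AddCircle (2 * Real.pi)) :=
  quasiMeasurePreserving_coe.ae_eq_comp hfg

theorem L2Circle.fn_periodic (f : L2Circle) : Function.Periodic f.fn (2 * Real.pi) := by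
  intro x
  simp only [L2Circle.fn, AddCircle.coe_add_period]

theorem L2Circle.fn_add (f g : L2Circle) : (f + g).fn =ᵐ[volume] fun x => f.fn x + g.fn x :=
  L2Circle.fn_ae_real _ _ (Lp.coeFn_add f g)

theorem L2Circle.fn_smul (c : ℝ) (f : L2Circle) :
    (c • f).fn =ᵐ[volume] fun x => c * f.fn x :=
  L2Circle.fn_ae_real _ _ (Lp.coeFn_smul c f)

theorem L2Circle.ext_fn {f g : L2Circle}
    (h : f.fn =ᵐ[volume.restrict (Ioc 0 (2 * Real.pi))] g.fn) : f = g := by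
  have mp := AddCircle.measurePreserving_mk (2 * Real.pi) 0
  rw [zero_add] at mp
  refine Lp.ext ?_
  have h2 := (ae_map_iff mp.measurable.aemeasurable
      (measurableSet_eq_fun (Lp.stronglyMeasurable f).measurable
        (Lp.stronglyMeasurable g).measurable)).2 h
  rwa [mp.map_eq] at h2

theorem L2Circle.memLp_fn (f : L2Circle) (a : ℝ) :
    MemLp f.fn 2 (volume.restrict (Ioc a (a + 2 * Real.pi))) :=
  (Lp.memLp f).comp_measurePreserving (AddCircle.measurePreserving_mk (2 * Real.pi) a)

theorem L2Circle.intervalIntegrable_fn (f : L2Circle) (a b : ℝ) :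
    IntervalIntegrable f.fn volume a b := by
  refine f.fn_periodic.intervalIntegrable₀ Real.two_pi_pos.ne' ?_ a b
  rw [intervalIntegrable_iff_integrableOn_Ioc_of_le Real.two_pi_pos.le]
  have := (f.memLp_fn 0).integrable (by norm_num)
  rwa [zero_add] at this

theorem L2Circle.integral_inner (f g : L2Circle) :
    inner ℝ f g = ∫ x in (0 : ℝ)..(2 * Real.pi), f.fn x * g.fn x := by
  rw [L2.inner_def]
  have := AddCircle.intervalIntegral_preimage (2 * Real.pi) 0
    (fun x : AddCircle (2 * Real.pi) => inner ℝ (f x) (g x))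
  rw [zero_add] at this
  rw [← this]
  refine intervalIntegral.integral_congr fun x _ => ?_
  simp [L2Circle.fn, mul_comm]

theorem L2Circle.norm_sq_eq_integral (f : L2Circle) (a : ℝ) :
    ‖f‖ ^ 2 = ∫ x in a..(a + 2 * Real.pi), f.fn x ^ 2 := by
  have hp : Function.Periodic (fun x => f.fn x ^ 2) (2 * Real.pi) := fun x => by
    simp only [f.fn_periodic x]
  rw [← real_inner_self_eq_norm_sq, L2Circle.integral_inner, hp.intervalIntegral_add_eq a 0,
    zero_add]
  exact intervalIntegral.integral_congr fun x _ => (sq _).symm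

/-- A continuous `2π`-periodic function, as a continuous function on the circle. -/
noncomputable def circleMap (ψ : ℝ → ℝ) (hc : Continuous ψ)
    (hp : Function.Periodic ψ (2 * Real.pi)) : C(AddCircle (2 * Real.pi), ℝ) where
  toFun := hp.lift
  continuous_toFun := by
    refine continuous_coinduced_dom.mpr ?_
    exact hc

@[simp] theorem circleMap_coe (ψ : ℝ → ℝ) (hc : Continuous ψ)
    (hp : Function.Periodic ψ (2 * Real.pi)) (x : ℝ) :
    circleMap ψ hc hp (x : AddCircle (2 * Real.pi)) = ψ x := rfl

/-- The class in `L²` of a continuous function on the circle. -/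
noncomputable def toL2 : C(AddCircle (2 * Real.pi), ℝ) →L[ℝ] L2Circle :=
  ContinuousMap.toLp 2 volume ℝ

theorem fn_toL2 (F : C(AddCircle (2 * Real.pi), ℝ)) :
    (toL2 F).fn =ᵐ[volume] fun x => F (x : AddCircle (2 * Real.pi)) :=
  L2Circle.fn_ae_real _ _ (ContinuousMap.coeFn_toLp (𝕜 := ℝ) volume F)

theorem integral_mul_sq_le {s : Set ℝ} {f g : ℝ → ℝ} 
    (hf : MemLp f 2 (volume.restrict s)) (hg : MemLp g 2 (volume.restrict s)) :
    |∫ x in s, f x * g x| ≤ √(∫ x in s, f x ^ 2) * √(∫ x in s, g x ^ 2) := by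
  have h := abs_real_inner_le_norm (hf.toLp f) (hg.toLp g)
  have h1 : inner ℝ (hf.toLp f) (hg.toLp g) = ∫ x in s, f x * g x := by
    rw [L2.inner_def]
    refine integral_congr_ae ?_
    filter_upwards [hf.coeFn_toLp, hg.coeFn_toLp] with x h1 h2
    rw [h1, h2]
    simp [mul_comm]
  have h2 : ∀ {f : ℝ → ℝ} (hf : MemLp f 2 (volume.restrict s)),
      ‖hf.toLp f‖ = √(∫ x in s, f x ^ 2) := by
    intro f hf
    rw [← Real.sqrt_sq (norm_nonneg (hf.toLp f)), ← real_inner_self_eq_norm_sq, L2.inner_def]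
    congr 1
    refine integral_congr_ae ?_
    filter_upwards [hf.coeFn_toLp] with x h1
    rw [h1]
    simp [sq]
  rwa [h1, h2, h2] at h

theorem L2Circle.abs_integral_mul_le (f : L2Circle) (ψ : ℝ → ℝ) (hψ : Continuous ψ) {a b : ℝ}
    (hab : a ≤ b) (hb : b ≤ a + 2 * Real.pi) :
    |∫ x in a..b, f.fn x * ψ x| ≤ √(∫ x in a..b, ψ x ^ 2) * ‖f‖ := by
  rw [intervalIntegral.integral_of_le hab, intervalIntegral.integral_of_le hab]
  have hsub : Ioc a b ⊆ Ioc a (a + 2 * Real.pi) := Ioc_subset_Ioc_right hb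
  have hf : MemLp f.fn 2 (volume.restrict (Ioc a b)) :=
    (f.memLp_fn a).mono_measure (Measure.restrict_mono_set _ hsub)
  have hg : MemLp ψ 2 (volume.restrict (Ioc a b)) := by
    obtain ⟨M, hM⟩ := isCompact_Icc.exists_bound_of_continuousOn (s := Icc a b) hψ.continuousOn
    refine MemLp.of_bound hψ.aestronglyMeasurable M ?_
    filter_upwards [ae_restrict_mem measurableSet_Ioc] with x hx
    exact hM x (Ioc_subset_Icc_self hx)
  refine (integral_mul_sq_le hf hg).trans ?_
  rw [mul_comm]
  refine mul_le_mul_of_nonneg_left ?_ (Real.sqrt_nonneg _)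
  rw [← Real.sqrt_sq (norm_nonneg f), f.norm_sq_eq_integral a,
    intervalIntegral.integral_of_le (by linarith [Real.two_pi_pos])]
  refine Real.sqrt_le_sqrt ?_
  refine setIntegral_mono_set ?_ (Eventually.of_forall fun x => sq_nonneg _) hsub.eventuallyLE
  exact (f.memLp_fn a).integrable_sq

/-- Cauchy–Schwarz against the constant 1. Applied to a weak derivative, it is the source of the
Hölder-1/2 bound in H¹. -/
theorem L2Circle.abs_integral_le (f : L2Circle) {a b : ℝ} (h : |b - a| ≤ 2 * Real.pi) :
    |∫ x in a..b, f.fn x| ≤ √|b - a| * ‖f‖ := by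
  wlog hab : a ≤ b generalizing a b
  · rw [intervalIntegral.integral_symm, abs_neg, abs_sub_comm]
    exact this (by rwa [abs_sub_comm]) (le_of_not_ge hab)
  rw [abs_of_nonneg (sub_nonneg.2 hab)] at h ⊢
  simpa using f.abs_integral_mul_le (fun _ => 1) continuous_const hab (by linarith)

theorem L2Circle.intervalIntegral_add (f g : L2Circle) (a b : ℝ) :
    ∫ x in a..b, (f + g).fn x = (∫ x in a..b, f.fn x) + ∫ x in a..b, g.fn x := by
  rw [← intervalIntegral.integral_add (f.intervalIntegrable_fn a b) (g.intervalIntegrable_fn a b)]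
  refine intervalIntegral.integral_congr_ae ?_
  filter_upwards [L2Circle.fn_add f g] with x hx _ using hx

theorem L2Circle.intervalIntegral_smul (c : ℝ) (f : L2Circle) (a b : ℝ) :
    ∫ x in a..b, (c • f).fn x = c * ∫ x in a..b, f.fn x := by
  rw [← intervalIntegral.integral_const_mul]
  refine intervalIntegral.integral_congr_ae ?_
  filter_upwards [L2Circle.fn_smul c f] with x hx _ using hx

/-- Integration over one period against a continuous function. -/
noncomputable def periodPairing (ψ : ℝ → ℝ) (hψ : Continuous ψ) : L2Circle →L[ℝ] ℝ :=
  LinearMap.mkContinuous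
    { toFun := fun f => ∫ x in (0 : ℝ)..(2 * Real.pi), f.fn x * ψ x
      map_add' := fun f g => L2Circle.integral_add f g ψ hψ
      map_smul' := fun c f => L2Circle.integral_smul c f ψ }
    (√(∫ x in (0 : ℝ)..(2 * Real.pi), ψ x ^ 2))
    (fun f => f.abs_integral_mul_le ψ hψ Real.two_pi_pos.le (by simp))

theorem periodPairing_apply (ψ : ℝ → ℝ) (hψ : Continuous ψ) (f : L2Circle) :
    periodPairing ψ hψ f = ∫ x in (0 : ℝ)..(2 * Real.pi), f.fn x * ψ x := rfl

theorem memLp_cmul (F : C(AddCircle (2 * Real.pi), ℝ)) (f : L2Circle) :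
    MemLp (fun x => F x * f x) 2 (volume : Measure (AddCircle (2 * Real.pi))) := by
  refine MemLp.of_le_mul (c := ‖F‖) (Lp.memLp f)
    (F.continuous.aestronglyMeasurable.mul (Lp.memLp f).1) (Eventually.of_forall fun x => ?_)
  rw [norm_mul]
  exact mul_le_mul_of_nonneg_right (F.norm_coe_le_norm x) (norm_nonneg _)

/-- Multiplication of a square integrable function by a continuous one. -/
noncomputable def cmul (F : C(AddCircle (2 * Real.pi), ℝ)) (f : L2Circle) : L2Circle :=
  MemLp.toLp (fun x => F x * f x) (memLp_cmul F f)

theorem fn_cmul (F : C(AddCircle (2 * Real.pi), ℝ)) (f : L2Circle) :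
    (cmul F f).fn =ᵐ[volume] fun x => F (x : AddCircle (2 * Real.pi)) * f.fn x :=
  L2Circle.fn_ae_real _ _ (MemLp.coeFn_toLp _)

theorem norm_cmul_le (F : C(AddCircle (2 * Real.pi), ℝ)) (f : L2Circle) :
    ‖cmul F f‖ ≤ ‖F‖ * ‖f‖ := by
  refine Lp.norm_le_mul_norm_of_ae_le_mul ?_
  filter_upwards [MemLp.coeFn_toLp (memLp_cmul F f)] with x hx
  rw [cmul, hx, norm_mul]
  exact mul_le_mul_of_nonneg_right (F.norm_coe_le_norm x) (norm_nonneg _)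

/-- `cmul` as a bounded bilinear map. -/
noncomputable def cmulL : C(AddCircle (2 * Real.pi), ℝ) →L[ℝ] L2Circle →L[ℝ] L2Circle :=
  LinearMap.mkContinuous₂
    (LinearMap.mk₂ ℝ cmul
      (fun F G f => by
        refine L2Circle.ext_fn (ae_restrict_of_ae ?_)
        filter_upwards [fn_cmul (F + G) f, fn_cmul F f, fn_cmul G f,
          L2Circle.fn_add (cmul F f) (cmul G f)] with x h1 h2 h3 h4
        rw [h1, h4, h2, h3, ContinuousMap.add_apply, add_mul])
      (fun c F f => by
        refine L2Circle.ext_fn (ae_restrict_of_ae ?_)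
        filter_upwards [fn_cmul (c • F) f, fn_cmul F f,
          L2Circle.fn_smul c (cmul F f)] with x h1 h2 h4
        rw [h1, h4, h2, ContinuousMap.smul_apply, smul_eq_mul, mul_assoc])
      (fun F f g => by
        refine L2Circle.ext_fn (ae_restrict_of_ae ?_)
        filter_upwards [fn_cmul F (f + g), fn_cmul F f, fn_cmul F g, L2Circle.fn_add f g,
          L2Circle.fn_add (cmul F f) (cmul F g)] with x h1 h2 h3 h4 h5
        rw [h1, h5, h2, h3, h4, mul_add])
      (fun c F f => by
        refine L2Circle.ext_fn (ae_restrict_of_ae ?_)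
        filter_upwards [fn_cmul F (c • f), fn_cmul F f, L2Circle.fn_smul c f,
          L2Circle.fn_smul c (cmul F f)] with x h1 h2 h3 h4
        rw [h1, h4, h2, h3, mul_left_comm]))
    1 (fun F f => by rw [one_mul]; exact norm_cmul_le F f)

/-! ### Smooth periodic functions in `H¹` -/

theorem _root_.Function.Periodic.deriv_real {ψ : ℝ → ℝ} {c : ℝ} (hp : Function.Periodic ψ c) :
    Function.Periodic (deriv ψ) c := by
  intro x
  rw [← deriv_comp_add_const]
  congr 1
  exact funext hp

theorem periodPairing_toL2 (F : C(AddCircle (2 * Real.pi), ℝ)) (ψ : ℝ → ℝ) (hψ : Continuous ψ) :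
    periodPairing ψ hψ (toL2 F)
      = ∫ x in (0 : ℝ)..(2 * Real.pi), F (x : AddCircle (2 * Real.pi)) * ψ x := by
  rw [periodPairing_apply]
  refine intervalIntegral.integral_congr_ae ?_
  filter_upwards [fn_toL2 F] with x hx _
  rw [hx]

/-- Stated as the vanishing of continuous functionals, the condition becomes accessible to
closedness and density arguments. -/
theorem isWeakDeriv_iff_periodPairing (f g : L2Circle) :
    IsWeakDeriv f g ↔ ∀ (ψ : ℝ → ℝ) (h : ContDiff ℝ ∞ ψ), Function.Periodic ψ (2 * Real.pi) →
      periodPairing (deriv ψ) (h.continuous_deriv (by simp)) f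
        + periodPairing ψ h.continuous g = 0 := by
  refine forall_congr' fun ψ => forall_congr' fun h => forall_congr' fun hp => ?_
  rw [periodPairing_apply, periodPairing_apply, eq_neg_iff_add_eq_zero]

theorem integral_mul_deriv_of_periodic {χ ψ : ℝ → ℝ} {T : ℝ} (hχ : ContDiff ℝ 1 χ)
    (hχp : Function.Periodic χ T) (hψ : ContDiff ℝ 1 ψ) (hψp : Function.Periodic ψ T) :
    ∫ x in (0 : ℝ)..T, χ x * deriv ψ x = -∫ x in (0 : ℝ)..T, deriv χ x * ψ x := by
  rw [intervalIntegral.integral_mul_deriv_eq_deriv_mul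
    (fun x _ => (hχ.differentiable (by simp) x).hasDerivAt)
    (fun x _ => (hψ.differentiable (by simp) x).hasDerivAt)
    ((hχ.continuous_deriv le_rfl).intervalIntegrable _ _)
    ((hψ.continuous_deriv le_rfl).intervalIntegrable _ _)]
  have h1 : χ T = χ 0 := by simpa using hχp 0
  have h2 : ψ T = ψ 0 := by simpa using hψp 0
  rw [h1, h2]
  ring

theorem isWeakDeriv_toL2 {χ : ℝ → ℝ} (hχ : ContDiff ℝ 1 χ)
    (hp : Function.Periodic χ (2 * Real.pi)) :
    IsWeakDeriv (toL2 (circleMap χ hχ.continuous hp))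
      (toL2 (circleMap (deriv χ) (hχ.continuous_deriv le_rfl) hp.deriv_real)) := by
  intro ψ h1 h2
  have e1 := periodPairing_toL2 (circleMap χ hχ.continuous hp) (deriv ψ)
    (h1.continuous_deriv (by simp))
  have e2 := periodPairing_toL2 (circleMap (deriv χ) (hχ.continuous_deriv le_rfl) hp.deriv_real)
    ψ h1.continuous
  rw [periodPairing_apply] at e1 e2
  rw [e1, e2]
  exact integral_mul_deriv_of_periodic hχ hp (h1.of_le (by simp)) h2

/-- A `C¹` periodic function as an element of `H¹`. -/
noncomputable def smoothH1 (χ : ℝ → ℝ) (hχ : ContDiff ℝ 1 χ)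
    (hp : Function.Periodic χ (2 * Real.pi)) : H1 :=
  ⟨WithLp.toLp 2 (toL2 (circleMap χ hχ.continuous hp),
    toL2 (circleMap (deriv χ) (hχ.continuous_deriv le_rfl) hp.deriv_real)),
    isWeakDeriv_toL2 hχ hp⟩

/-- The underlying `L²` function of an element of `H¹`. -/
noncomputable def valL : H1 →L[ℝ] L2Circle :=
  (WithLp.fstL 2 ℝ L2Circle L2Circle).comp h1Submodule.subtypeL

/-- The weak derivative of an element of `H¹`. -/
noncomputable def derL : H1 →L[ℝ] L2Circle :=
  (WithLp.sndL 2 ℝ L2Circle L2Circle).comp h1Submodule.subtypeL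

theorem H1.isWeakDeriv (f : H1) : IsWeakDeriv (valL f) (derL f) := f.2

theorem valL_smoothH1 (χ : ℝ → ℝ) (hχ : ContDiff ℝ 1 χ)
    (hp : Function.Periodic χ (2 * Real.pi)) :
    valL (smoothH1 χ hχ hp) = toL2 (circleMap χ hχ.continuous hp) := rfl

theorem derL_smoothH1 (χ : ℝ → ℝ) (hχ : ContDiff ℝ 1 χ)
    (hp : Function.Periodic χ (2 * Real.pi)) :
    derL (smoothH1 χ hχ hp) =
      toL2 (circleMap (deriv χ) (hχ.continuous_deriv le_rfl) hp.deriv_real) := rfl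

theorem H1.inner_eq (f g : H1) :
    inner ℝ f g = inner ℝ (valL f) (valL g) + inner ℝ (derL f) (derL g) :=
  WithLp.prod_inner_apply _ _

theorem H1.norm_sq_eq (f : H1) : ‖f‖ ^ 2 = ‖valL f‖ ^ 2 + ‖derL f‖ ^ 2 := by
  simp only [← real_inner_self_eq_norm_sq, H1.inner_eq]

theorem norm_valL_le (f : H1) : ‖valL f‖ ≤ ‖f‖ := by
  refine le_of_sq_le_sq ?_ (norm_nonneg _)
  rw [f.norm_sq_eq]
  nlinarith [sq_nonneg ‖derL f‖]

theorem norm_derL_le (f : H1) : ‖derL f‖ ≤ ‖f‖ := by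
  refine le_of_sq_le_sq ?_ (norm_nonneg _)
  rw [f.norm_sq_eq]
  nlinarith [sq_nonneg ‖valL f‖]

/-! ### The real trigonometric system: orthogonality, completeness, density in H¹ -/

/-- The function `cos (n x) + sin (n x)`. -/
noncomputable def cas (n : ℤ) (x : ℝ) : ℝ := Real.cos (n * x) + Real.sin (n * x)

/-- Differentiation reflects the index and scales. The Hilbert transform will act in the same way,
so one real function per integer does the work of the complex exponentials. -/
theorem hasDerivAt_cas (n : ℤ) (x : ℝ) : HasDerivAt (cas n) (n * cas (-n) x) x := by
  have h : HasDerivAt (fun y : ℝ => (n : ℝ) * y) n x := by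
    simpa using (hasDerivAt_id x).const_mul (n : ℝ)
  refine HasDerivAt.congr_deriv (f := cas n) (h.cos.add h.sin) ?_
  simp only [cas, Int.cast_neg, neg_mul, Real.cos_neg, Real.sin_neg]
  ring

theorem deriv_cas (n : ℤ) : deriv (cas n) = fun x => n * cas (-n) x :=
  funext fun x => (hasDerivAt_cas n x).deriv

theorem contDiff_cas (n : ℤ) {k : WithTop ℕ∞} : ContDiff ℝ k (cas n) := by
  unfold cas
  fun_prop

theorem continuous_cas (n : ℤ) : Continuous (cas n) := (contDiff_cas n (k := 0)).continuous

theorem cas_periodic (n : ℤ) : Function.Periodic (cas n) (2 * Real.pi) := by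
  intro x
  simp only [cas, mul_add, Real.cos_add_int_mul_two_pi, Real.sin_add_int_mul_two_pi]

theorem integral_cos_int_mul (n : ℤ) :
    ∫ x in (0 : ℝ)..(2 * Real.pi), Real.cos (n * x) = if n = 0 then 2 * Real.pi else 0 := by
  split_ifs with h
  · simp [h]
  · have hn : (n : ℝ) ≠ 0 := Int.cast_ne_zero.2 h
    rw [intervalIntegral.integral_comp_mul_left (fun x => Real.cos x) hn, integral_cos]
    have := Real.sin_add_int_mul_two_pi 0 n
    rw [zero_add, Real.sin_zero] at this
    simp [this]

theorem integral_sin_int_mul (n : ℤ) :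
    ∫ x in (0 : ℝ)..(2 * Real.pi), Real.sin (n * x) = 0 := by
  by_cases h : n = 0
  · simp [h]
  · have hn : (n : ℝ) ≠ 0 := Int.cast_ne_zero.2 h
    rw [intervalIntegral.integral_comp_mul_left (fun x => Real.sin x) hn, integral_sin]
    simp [Real.cos_int_mul_two_pi]

/-- The product is a cosine of the difference frequency plus a sine of the sum frequency, and the
sine always integrates to zero. -/
theorem integral_cas_mul_cas (n m : ℤ) :
    ∫ x in (0 : ℝ)..(2 * Real.pi), cas n x * cas m x = if n = m then 2 * Real.pi else 0 := by
  have h : ∀ x, cas n x * cas m x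
      = Real.cos ((n - m : ℤ) * x) + Real.sin ((n + m : ℤ) * x) := by
    intro x
    simp only [cas, Int.cast_sub, Int.cast_add, sub_mul, add_mul, Real.cos_sub, Real.sin_add]
    ring
  simp only [h]
  rw [intervalIntegral.integral_add
    ((by fun_prop : Continuous fun x : ℝ => Real.cos ((n - m : ℤ) * x)).intervalIntegrable _ _)
    ((by fun_prop : Continuous fun x : ℝ => Real.sin ((n + m : ℤ) * x)).intervalIntegrable _ _),
    integral_cos_int_mul, integral_sin_int_mul, add_zero]
  simp only [sub_eq_zero]

/-- The functions `cas n` in `L²`. -/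
noncomputable def casL2 (n : ℤ) : L2Circle :=
  toL2 (circleMap (cas n) (continuous_cas n) (cas_periodic n))

theorem fn_casL2 (n : ℤ) : (casL2 n).fn =ᵐ[volume] cas n := fn_toL2 _

theorem inner_casL2_left (n : ℤ) (f : L2Circle) :
    inner ℝ (casL2 n) f = periodPairing (cas n) (continuous_cas n) f := by
  rw [L2Circle.integral_inner, periodPairing_apply]
  refine intervalIntegral.integral_congr_ae ?_
  filter_upwards [fn_casL2 n] with x hx _
  rw [hx, mul_comm]

theorem inner_casL2 (n m : ℤ) :
    inner ℝ (casL2 n) (casL2 m) = if n = m then 2 * Real.pi else 0 := by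
  rw [inner_casL2_left, casL2, periodPairing_toL2, ← integral_cas_mul_cas]
  refine intervalIntegral.integral_congr fun x _ => ?_
  simp [mul_comm]

/-- The functions `cas n` in `H¹`. -/
noncomputable def casH1 (n : ℤ) : H1 := smoothH1 (cas n) (contDiff_cas n) (cas_periodic n)

theorem valL_casH1 (n : ℤ) : valL (casH1 n) = casL2 n := rfl

theorem derL_casH1 (n : ℤ) : derL (casH1 n) = (n : ℝ) • casL2 (-n) := by
  rw [casH1, derL_smoothH1, casL2, ← map_smul]
  congr 1
  ext x
  induction x using QuotientAddGroup.induction_on with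
  | H x => simp [circleMap, Function.Periodic.lift_coe, deriv_cas]

theorem inner_casH1 (n m : ℤ) :
    inner ℝ (casH1 n) (casH1 m) = if n = m then 2 * Real.pi * (1 + n ^ 2) else 0 := by
  rw [H1.inner_eq, valL_casH1, valL_casH1, derL_casH1, derL_casH1, inner_smul_left,
    inner_smul_right, inner_casL2, inner_casL2]
  simp only [neg_inj, conj_trivial]
  split_ifs with h
  · subst h; ring
  · simp

theorem norm_casH1 (n : ℤ) : ‖casH1 n‖ = √(2 * Real.pi * (1 + n ^ 2)) := by
  rw [← Real.sqrt_sq (norm_nonneg (casH1 n)), ← real_inner_self_eq_norm_sq, inner_casH1, if_pos rfl]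

theorem norm_casH1_pos (n : ℤ) : 0 < ‖casH1 n‖ := by
  rw [norm_casH1]
  have := Real.pi_pos
  positivity

theorem fourier_neg_eq_cas (n : ℤ) (x : ℝ) :
    (fourier (-n) (x : AddCircle (2 * Real.pi)) : ℂ)
      = (1 - Complex.I) / 2 * (cas n x : ℂ) + (1 + Complex.I) / 2 * (cas (-n) x : ℂ) := by
  have h1 : (fourier (-n) (x : AddCircle (2 * Real.pi)) : ℂ)
      = Complex.exp (((-(n * x) : ℝ) : ℂ) * Complex.I) := by
    rw [fourier_coe_apply]
    congr 1
    have := Real.pi_ne_zero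
    push_cast
    field_simp
  rw [h1, Complex.exp_mul_I, ← Complex.ofReal_cos, ← Complex.ofReal_sin]
  simp only [cas, Real.cos_neg, Real.sin_neg, Int.cast_neg, neg_mul]
  push_cast
  ring

/-- Each complex Fourier coefficient is a combination of the pairings with `cas n` and `cas (-n)`,
so completeness follows from that of the Fourier basis. -/
theorem eq_zero_of_forall_integral_cas (f : L2Circle)
    (h : ∀ n : ℤ, periodPairing (cas n) (continuous_cas n) f = 0) : f = 0 := by
  have hm : MemLp (fun x => (f x : ℂ)) 2 (AddCircle.haarAddCircle (T := 2 * Real.pi)) :=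
    memLp_haarAddCircle_iff.2 (Lp.memLp f).ofReal
  have hI : ∀ n : ℤ, IntervalIntegrable (fun x => ((f.fn x * cas n x : ℝ) : ℂ)) volume 0
      (2 * Real.pi) := fun n =>
    ⟨(f.fn_integrable (cas n) (continuous_cas n)).1.ofReal,
      (f.fn_integrable (cas n) (continuous_cas n)).2.ofReal⟩
  have hc : ∀ n : ℤ, fourierCoeff (fun x => (f x : ℂ)) n = 0 := by
    intro n
    rw [fourierCoeff_eq_intervalIntegral _ n 0, zero_add]
    have e : ∀ x : ℝ, (fourier (-n) (x : AddCircle (2 * Real.pi)) : ℂ) • ((f x : ℝ) : ℂ)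
        = (1 - Complex.I) / 2 * ((f.fn x * cas n x : ℝ) : ℂ)
          + (1 + Complex.I) / 2 * ((f.fn x * cas (-n) x : ℝ) : ℂ) := by
      intro x
      rw [fourier_neg_eq_cas, smul_eq_mul, L2Circle.fn]
      push_cast
      ring
    simp only [e]
    rw [intervalIntegral.integral_add ((hI n).const_mul _) ((hI (-n)).const_mul _),
      intervalIntegral.integral_const_mul, intervalIntegral.integral_const_mul,
      intervalIntegral.integral_ofReal, intervalIntegral.integral_ofReal,
      ← periodPairing_apply _ (continuous_cas n), ← periodPairing_apply _ (continuous_cas (-n)),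
      h, h]
    simp
  have hz : hm.toLp _ = 0 := by
    rw [← LinearIsometryEquiv.map_eq_zero_iff (fourierBasis (T := 2 * Real.pi)).repr]
    ext n
    rw [fourierBasis_repr, fourierCoeff_congr_ae hm.coeFn_toLp, hc]
    rfl
  have h0 : (fun x => (f x : ℂ)) =ᵐ[AddCircle.haarAddCircle] 0 := by
    have := hm.coeFn_toLp
    rw [hz] at this
    exact this.symm.trans (Lp.coeFn_zero _ _ _)
  refine Lp.ext ?_
  refine EventuallyEq.trans ?_ (Lp.coeFn_zero _ _ _).symm
  have h2 : ∀ᵐ x ∂(AddCircle.haarAddCircle (T := 2 * Real.pi)), f x = 0 := by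
    filter_upwards [h0] with x hx
    simpa using hx
  -- The Lebesgue measure of the circle is a multiple of the Haar probability measure used by the
  -- Fourier basis.
  exact Measure.ae_smul_measure h2 _

theorem periodPairing_smul_cas (n : ℤ) (f : L2Circle) (h : Continuous (deriv (cas n))) :
    periodPairing (deriv (cas n)) h f = n * periodPairing (cas (-n)) (continuous_cas _) f := by
  rw [periodPairing_apply, periodPairing_apply, ← intervalIntegral.integral_const_mul, deriv_cas]
  refine intervalIntegral.integral_congr fun x _ => ?_
  ring

theorem H1.periodPairing_derL (f : H1) (n : ℤ) :
    periodPairing (cas n) (continuous_cas n) (derL f)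
      = -(n * periodPairing (cas (-n)) (continuous_cas _) (valL f)) := by
  have h := (isWeakDeriv_iff_periodPairing _ _).1 f.isWeakDeriv (cas n) (contDiff_cas n)
    (cas_periodic n)
  rw [periodPairing_smul_cas] at h
  linarith

/-- Testing against `cas n` shows that the trigonometric pairings of the weak derivative are
determined by those of the function. -/
theorem H1.ext_valL {f g : H1} (h : valL f = valL g) : f = g := by
  have h0 : valL (f - g) = 0 := by rw [map_sub, h, sub_self]
  have h1 : derL (f - g) = 0 := by
    refine eq_zero_of_forall_integral_cas _ fun n => ?_
    rw [H1.periodPairing_derL, h0, map_zero, mul_zero, neg_zero]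
  rw [← sub_eq_zero, ← norm_eq_zero, ← sq_eq_zero_iff, H1.norm_sq_eq, h0, h1]
  simp

theorem H1.ext_fn {f g : H1} (h : f.fn =ᵐ[volume] g.fn) : f = g :=
  H1.ext_valL (L2Circle.ext_fn (ae_restrict_of_ae h))

/-- An intersection of zero sets of continuous functionals. This gives the completeness that
Picard–Lindelöf requires. -/
theorem isClosed_h1Submodule : IsClosed (h1Submodule : Set (WithLp 2 (L2Circle × L2Circle))) := by
  have : (h1Submodule : Set (WithLp 2 (L2Circle × L2Circle))) =
      ⋂ (ψ : ℝ → ℝ) (h : ContDiff ℝ ∞ ψ) (_ : Function.Periodic ψ (2 * Real.pi)),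
        {p | periodPairing (deriv ψ) (h.continuous_deriv (by simp)) p.fst
          + periodPairing ψ h.continuous p.snd = 0} := by
    ext p
    simp only [mem_iInter]
    exact isWeakDeriv_iff_periodPairing _ _
  rw [this]
  refine isClosed_iInter fun ψ => isClosed_iInter fun h => isClosed_iInter fun hp => ?_
  refine isClosed_eq ?_ continuous_const
  exact ((periodPairing _ _).continuous.comp (WithLp.fstL 2 ℝ L2Circle L2Circle).continuous).add
    ((periodPairing _ _).continuous.comp (WithLp.sndL 2 ℝ L2Circle L2Circle).continuous)

instance H1.instCompleteSpace : CompleteSpace H1 := isClosed_h1Submodule.completeSpace_coe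

theorem H1.inner_casH1_left (n : ℤ) (f : H1) :
    inner ℝ (casH1 n) f = (1 + n ^ 2) * periodPairing (cas n) (continuous_cas n) (valL f) := by
  rw [H1.inner_eq, valL_casH1, derL_casH1, inner_smul_left, inner_casL2_left, inner_casL2_left,
    H1.periodPairing_derL]
  simp only [neg_neg, Int.cast_neg, conj_trivial]
  ring

/-- The H¹ product with `cas n` is (1 + n²) times the L² pairing, so a vector orthogonal to the span
has all its pairings zero. -/
theorem span_casH1_topologicalClosure :
    (Submodule.span ℝ (range casH1)).topologicalClosure = ⊤ := by
  rw [Submodule.topologicalClosure_eq_top_iff, Submodule.eq_bot_iff]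
  intro f hf
  refine H1.ext_valL ?_
  rw [map_zero]
  refine eq_zero_of_forall_integral_cas _ fun n => ?_
  have h := (Submodule.mem_orthogonal _ f).1 hf (casH1 n) (Submodule.subset_span ⟨n, rfl⟩)
  rw [H1.inner_casH1_left] at h
  refine (mul_eq_zero.1 h).resolve_left ?_
  positivity

theorem dense_span_casH1 : Dense (Submodule.span ℝ (range casH1) : Set H1) := by
  rw [dense_iff_closure_eq, ← Submodule.topologicalClosure_coe, span_casH1_topologicalClosure,
    Submodule.top_coe]

theorem H1.clm_ext {F : Type*} [AddCommMonoid F] [Module ℝ F] [TopologicalSpace F] [T2Space F]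
    {A B : H1 →L[ℝ] F} (h : ∀ n, A (casH1 n) = B (casH1 n)) : A = B :=
  ContinuousLinearMap.ext_on dense_span_casH1 (by rintro _ ⟨n, rfl⟩; exact h n)

/-! ### The continuous representative of an element of `H¹` -/

theorem derL_integral_period (f : H1) (x : ℝ) :
    ∫ y in x..(x + 2 * Real.pi), (derL f).fn y = 0 := by
  rw [(derL f).fn_periodic.intervalIntegral_add_eq x 0, zero_add]
  have h := f.periodPairing_derL 0
  simpa [periodPairing_apply, cas] using h

/-- The value at `0` of the continuous representative. -/
noncomputable def baseL : H1 →L[ℝ] ℝ :=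
  (1 / (2 * Real.pi)) • ((periodPairing (fun _ => 1) continuous_const).comp valL
    + (periodPairing (fun y => y) continuous_id).comp derL)

theorem continuous_primitive_derL (f : H1) :
    Continuous fun x => baseL f + ∫ y in (0 : ℝ)..x, (derL f).fn y :=
  continuous_const.add
    (intervalIntegral.continuous_primitive (fun a b => (derL f).intervalIntegrable_fn a b) 0)

theorem periodic_primitive_derL (f : H1) :
    Function.Periodic (fun x => baseL f + ∫ y in (0 : ℝ)..x, (derL f).fn y) (2 * Real.pi) := by
  intro x
  have h := intervalIntegral.integral_add_adjacent_intervals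
    ((derL f).intervalIntegrable_fn 0 x) ((derL f).intervalIntegrable_fn x (x + 2 * Real.pi))
  rw [derL_integral_period, add_zero] at h
  simp only [h]

theorem norm_circleMap_primitive_le (f : H1) :
    ‖circleMap _ (continuous_primitive_derL f) (periodic_primitive_derL f)‖
      ≤ (‖baseL‖ + √(2 * Real.pi)) * ‖f‖ := by
  rw [ContinuousMap.norm_le _ (by positivity)]
  intro x
  obtain ⟨y, hy, rfl⟩ := AddCircle.eq_coe_Ico x
  change |baseL f + ∫ z in (0 : ℝ)..y, (derL f).fn z| ≤ _
  rw [add_mul]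
  refine (abs_add_le _ _).trans (add_le_add (baseL.le_opNorm f) ?_)
  have hy1 : |y - 0| ≤ 2 * Real.pi := by
    rw [sub_zero, abs_of_nonneg hy.1]; exact hy.2.le
  refine ((derL f).abs_integral_le hy1).trans ?_
  exact mul_le_mul (Real.sqrt_le_sqrt hy1) (norm_derL_le f) (norm_nonneg _) (Real.sqrt_nonneg _)

/-- The continuous representative of an element of `H¹`, as a function on the circle. -/
noncomputable def repL : H1 →L[ℝ] C(AddCircle (2 * Real.pi), ℝ) :=
  LinearMap.mkContinuous
    { toFun := fun f => circleMap _ (continuous_primitive_derL f) (periodic_primitive_derL f)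
      map_add' := fun f g => by
        ext x
        induction x using QuotientAddGroup.induction_on with
        | H x =>
          change baseL (f + g) + _ = (baseL f + _) + (baseL g + _)
          rw [map_add, map_add, L2Circle.intervalIntegral_add]
          ring
      map_smul' := fun c f => by
        ext x
        induction x using QuotientAddGroup.induction_on with
        | H x =>
          change baseL (c • f) + _ = c * (baseL f + _)
          rw [map_smul, map_smul, L2Circle.intervalIntegral_smul, smul_eq_mul]
          ring }
    (‖baseL‖ + √(2 * Real.pi)) norm_circleMap_primitive_le

theorem norm_repL_le (f : H1) : ‖repL f‖ ≤ (‖baseL‖ + √(2 * Real.pi)) * ‖f‖ :=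
  norm_circleMap_primitive_le f

/-- The continuous `2π`-periodic representative of an element of `H¹`. -/
noncomputable def H1.rep (f : H1) (x : ℝ) : ℝ := repL f (x : AddCircle (2 * Real.pi))

theorem H1.rep_eq (f : H1) (x : ℝ) :
    f.rep x = baseL f + ∫ y in (0 : ℝ)..x, (derL f).fn y := rfl

theorem H1.continuous_rep (f : H1) : Continuous f.rep := continuous_primitive_derL f

theorem H1.rep_periodic (f : H1) : Function.Periodic f.rep (2 * Real.pi) :=
  periodic_primitive_derL f

theorem H1.rep_sub_rep (f : H1) (x y : ℝ) : f.rep y - f.rep x = ∫ z in x..y, (derL f).fn z := by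
  rw [H1.rep_eq, H1.rep_eq, add_sub_add_left_eq_sub,
    intervalIntegral.integral_interval_sub_left ((derL f).intervalIntegrable_fn _ _)
      ((derL f).intervalIntegrable_fn _ _)]

theorem H1.abs_rep_sub_rep_le (f : H1) {x y : ℝ} (h : |y - x| ≤ 2 * Real.pi) :
    |f.rep y - f.rep x| ≤ √|y - x| * ‖f‖ := by
  rw [H1.rep_sub_rep]
  exact ((derL f).abs_integral_le h).trans
    (mul_le_mul_of_nonneg_left (norm_derL_le f) (Real.sqrt_nonneg _))

/-- Evaluation of the continuous representative at a point. -/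
noncomputable def evL (x : ℝ) : H1 →L[ℝ] ℝ :=
  (ContinuousMap.evalCLM ℝ (x : AddCircle (2 * Real.pi))).comp repL

theorem evL_apply (x : ℝ) (f : H1) : evL x f = f.rep x := rfl

theorem H1.rep_add (f g : H1) (x : ℝ) : (f + g).rep x = f.rep x + g.rep x := map_add (evL x) f g

theorem H1.rep_sub (f g : H1) (x : ℝ) : (f - g).rep x = f.rep x - g.rep x := map_sub (evL x) f g

theorem H1.rep_smul (c : ℝ) (f : H1) (x : ℝ) : (c • f).rep x = c * f.rep x :=
  map_smul (evL x) c f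

theorem rep_smoothH1 (χ : ℝ → ℝ) (hχ : ContDiff ℝ 1 χ)
    (hp : Function.Periodic χ (2 * Real.pi)) (x : ℝ) : (smoothH1 χ hχ hp).rep x = χ x := by
  have hc := hχ.continuous_deriv le_rfl
  have hd : ∀ x, HasDerivAt χ (deriv χ x) x := fun x => (hχ.differentiable (by simp) x).hasDerivAt
  have h1 : ∫ y in (0 : ℝ)..x, (derL (smoothH1 χ hχ hp)).fn y = χ x - χ 0 := by
    rw [← intervalIntegral.integral_eq_sub_of_hasDerivAt (fun x _ => hd x)
      (hc.intervalIntegrable _ _)]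
    refine intervalIntegral.integral_congr_ae ?_
    filter_upwards [fn_toL2 (circleMap (deriv χ) hc hp.deriv_real)] with y hy _
    rw [derL_smoothH1, hy, circleMap_coe]
  have h2 : baseL (smoothH1 χ hχ hp) = χ 0 := by
    have e : baseL (smoothH1 χ hχ hp) = 1 / (2 * Real.pi) *
        ((periodPairing (fun _ => 1) continuous_const) (valL (smoothH1 χ hχ hp))
          + (periodPairing (fun y => y) continuous_id) (derL (smoothH1 χ hχ hp))) := rfl
    rw [e, valL_smoothH1, derL_smoothH1, periodPairing_toL2, periodPairing_toL2]
    simp only [circleMap_coe, mul_one]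
    -- Integration by parts gives ∫χ + ∫yχ'(y) dy = 2π χ(2π) = 2π χ(0), which is the reason for the
    -- formula defining `baseL`.
    have hpart := intervalIntegral.integral_deriv_mul_eq_sub (a := 0) (b := 2 * Real.pi)
      (fun x _ => hd x) (fun x _ => hasDerivAt_id x) (hc.intervalIntegrable _ _)
      (continuous_const.intervalIntegrable _ _)
    simp only [id, mul_one, mul_zero, sub_zero] at hpart
    rw [intervalIntegral.integral_add
      ((by fun_prop : Continuous fun x => deriv χ x * x).intervalIntegrable _ _)
      (hχ.continuous.intervalIntegrable _ _)] at hpart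
    rw [add_comm, hpart]
    have h3 : χ (2 * Real.pi) = χ 0 := by simpa using hp 0
    rw [h3]
    have := Real.pi_ne_zero
    field_simp
  rw [H1.rep_eq, h1, h2]
  ring

theorem repL_smoothH1 (χ : ℝ → ℝ) (hχ : ContDiff ℝ 1 χ)
    (hp : Function.Periodic χ (2 * Real.pi)) :
    repL (smoothH1 χ hχ hp) = circleMap χ hχ.continuous hp := by
  ext x
  induction x using QuotientAddGroup.induction_on with
  | H x => exact rep_smoothH1 χ hχ hp x

theorem rep_casH1 (n : ℤ) (x : ℝ) : (casH1 n).rep x = cas n x := rep_smoothH1 _ _ _ _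

/-- Both sides are continuous in f and agree on the dense trigonometric span. This is what makes the
primitive of the weak derivative a representative of f. -/
theorem toL2_repL (f : H1) : toL2 (repL f) = valL f := by
  have h : toL2.comp repL = valL := by
    refine H1.clm_ext fun n => ?_
    change toL2 (repL (smoothH1 _ _ _)) = valL (smoothH1 _ _ _)
    rw [repL_smoothH1, valL_smoothH1]
  exact DFunLike.congr_fun h f

theorem H1.fn_ae_rep (f : H1) : f.fn =ᵐ[volume] f.rep := by
  have h := fn_toL2 (repL f)
  rw [toL2_repL] at h
  exact h

theorem H1.rep_eq_of_ae {f : H1} {F : ℝ → ℝ} (hF : Continuous F) (h : f.fn =ᵐ[volume] F) :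
    f.rep = F :=
  (Continuous.ae_eq_iff_eq volume f.continuous_rep hF).1 (f.fn_ae_rep.symm.trans h)

theorem H1.ext_rep {f g : H1} (h : ∀ x, f.rep x = g.rep x) : f = g :=
  H1.ext_fn ((f.fn_ae_rep.trans (Eventually.of_forall h)).trans g.fn_ae_rep.symm)

/-! ### Multiplication on `H¹` -/

theorem cmul_toL2 {χ ψ : ℝ → ℝ} (hχ : Continuous χ) (hχp : Function.Periodic χ (2 * Real.pi))
    (hψ : Continuous ψ) (hψp : Function.Periodic ψ (2 * Real.pi)) :
    cmul (circleMap χ hχ hχp) (toL2 (circleMap ψ hψ hψp))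
      = toL2 (circleMap (fun x => χ x * ψ x) (hχ.mul hψ) (hχp.mul hψp)) := by
  refine L2Circle.ext_fn (ae_restrict_of_ae ?_)
  filter_upwards [fn_cmul (circleMap χ hχ hχp) (toL2 (circleMap ψ hψ hψp)),
    fn_toL2 (circleMap ψ hψ hψp),
    fn_toL2 (circleMap (fun x => χ x * ψ x) (hχ.mul hψ) (hχp.mul hψp))] with x h1 h2 h3
  rw [h1, h2, h3]
  rfl

/-- The product of two elements of `H¹`, as an `L²` function. -/
noncomputable def mulVal : H1 →L[ℝ] H1 →L[ℝ] L2Circle :=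
  (cmulL.comp repL).bilinearComp (.id ℝ H1) valL

/-- The derivative of the product of two elements of `H¹`. -/
noncomputable def mulDer : H1 →L[ℝ] H1 →L[ℝ] L2Circle :=
  (cmulL.comp repL).bilinearComp (.id ℝ H1) derL
    + ((cmulL.comp repL).bilinearComp (.id ℝ H1) derL).flip

theorem mulVal_apply (f g : H1) : mulVal f g = cmul (repL f) (valL g) := rfl

theorem mulDer_apply (f g : H1) :
    mulDer f g = cmul (repL f) (derL g) + cmul (repL g) (derL f) := rfl

theorem isWeakDeriv_mul_casH1 (n m : ℤ) :
    IsWeakDeriv (mulVal (casH1 n) (casH1 m)) (mulDer (casH1 n) (casH1 m)) := by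
  have hd : ContDiff ℝ 1 fun x => cas n x * cas m x := (contDiff_cas n).mul (contDiff_cas m)
  have hp := (cas_periodic n).mul (cas_periodic m)
  convert isWeakDeriv_toL2 hd hp using 1
  · rw [mulVal_apply, casH1, casH1, repL_smoothH1, valL_smoothH1, cmul_toL2]
  · rw [mulDer_apply, casH1, casH1, repL_smoothH1, derL_smoothH1, cmul_toL2, repL_smoothH1,
      derL_smoothH1, cmul_toL2, ← map_add]
    congr 1
    ext x
    induction x using QuotientAddGroup.induction_on with
    | H x =>
      have : HasDerivAt (fun x => cas n x * cas m x) _ x :=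
        (hasDerivAt_cas n x).mul (hasDerivAt_cas m x)
      change cas n x * deriv (cas m) x + cas m x * deriv (cas n) x
        = deriv (fun x => cas n x * cas m x) x
      rw [this.deriv, deriv_cas, deriv_cas]
      ring

/-- For each test function the defect in the product rule is a continuous bilinear form on H¹, and
it vanishes on pairs of trigonometric functions by the classical rule. -/
theorem isWeakDeriv_mul (f g : H1) : IsWeakDeriv (mulVal f g) (mulDer f g) := by
  rw [isWeakDeriv_iff_periodPairing]
  intro ψ hψ hp
  have hc := hψ.continuous_deriv (by simp)
  let W : H1 →L[ℝ] H1 →L[ℝ] ℝ :=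
    (ContinuousLinearMap.compL ℝ H1 L2Circle ℝ (periodPairing (deriv ψ) hc)).comp mulVal
      + (ContinuousLinearMap.compL ℝ H1 L2Circle ℝ (periodPairing ψ hψ.continuous)).comp mulDer
  have hW : W = 0 := by
    refine H1.clm_ext fun n => H1.clm_ext fun m => ?_
    exact (isWeakDeriv_iff_periodPairing _ _).1 (isWeakDeriv_mul_casH1 n m) ψ hψ hp
  exact DFunLike.congr_fun (DFunLike.congr_fun hW f) g

/-- Multiplication on `H¹`. -/
noncomputable def H1.mul (f g : H1) : H1 :=
  ⟨WithLp.toLp 2 (mulVal f g, mulDer f g), isWeakDeriv_mul f g⟩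

theorem valL_mul (f g : H1) : valL (f.mul g) = mulVal f g := rfl

theorem derL_mul (f g : H1) : derL (f.mul g) = mulDer f g := rfl

/-- With A the sup-norm constant times ‖f‖ ‖g‖, the value contributes at most A and the derivative
at most 2A; the factor 3 rounds up √5. -/
theorem norm_mul_le_repL (f g : H1) :
    ‖f.mul g‖ ≤ 3 * (‖baseL‖ + √(2 * Real.pi)) * ‖f‖ * ‖g‖ := by
  have hv : ‖mulVal f g‖ ≤ (‖baseL‖ + √(2 * Real.pi)) * ‖f‖ * ‖g‖ :=
    (norm_cmul_le _ _).trans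
      (mul_le_mul (norm_repL_le f) (norm_valL_le g) (norm_nonneg _) (by positivity))
  have hd : ‖mulDer f g‖ ≤ 2 * (‖baseL‖ + √(2 * Real.pi)) * ‖f‖ * ‖g‖ := by
    refine (norm_add_le _ _).trans ?_
    have h1 : ‖cmul (repL f) (derL g)‖ ≤ (‖baseL‖ + √(2 * Real.pi)) * ‖f‖ * ‖g‖ :=
      (norm_cmul_le _ _).trans
        (mul_le_mul (norm_repL_le f) (norm_derL_le g) (norm_nonneg _) (by positivity))
    have h2 : ‖cmul (repL g) (derL f)‖ ≤ (‖baseL‖ + √(2 * Real.pi)) * ‖g‖ * ‖f‖ :=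
      (norm_cmul_le _ _).trans
        (mul_le_mul (norm_repL_le g) (norm_derL_le f) (norm_nonneg _) (by positivity))
    calc ‖cmul (repL f) (derL g)‖ + ‖cmul (repL g) (derL f)‖
        ≤ _ := add_le_add h1 h2
      _ = _ := by ring
  refine le_of_sq_le_sq ?_ (by positivity)
  rw [H1.norm_sq_eq, valL_mul, derL_mul]
  have := norm_nonneg (mulVal f g)
  have := norm_nonneg (mulDer f g)
  set A := (‖baseL‖ + √(2 * Real.pi)) * ‖f‖ * ‖g‖ with hA
  have e1 : 2 * (‖baseL‖ + √(2 * Real.pi)) * ‖f‖ * ‖g‖ = 2 * A := by rw [hA]; ring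
  have e2 : 3 * (‖baseL‖ + √(2 * Real.pi)) * ‖f‖ * ‖g‖ = 3 * A := by rw [hA]; ring
  rw [e1] at hd
  rw [e2]
  nlinarith

theorem isBoundedBilinearMap_mul : IsBoundedBilinearMap ℝ fun p : H1 × H1 => p.1.mul p.2 where
  add_left f g h := H1.ext_valL (by
    rw [map_add, valL_mul, valL_mul, valL_mul, map_add, add_apply])
  smul_left c f h := H1.ext_valL (by
    rw [map_smul, valL_mul, valL_mul, map_smul, smul_apply])
  add_right f g h := H1.ext_valL (by rw [map_add, valL_mul, valL_mul, valL_mul, map_add])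
  smul_right c f h := H1.ext_valL (by rw [map_smul, valL_mul, valL_mul, map_smul])
  bound := ⟨3 * (‖baseL‖ + √(2 * Real.pi)) + 1, by positivity, fun f g => by
    refine (norm_mul_le_repL f g).trans ?_
    gcongr
    linarith⟩

theorem H1.fn_mul (f g : H1) : (f.mul g).fn =ᵐ[volume] fun x => f.rep x * g.fn x :=
  fn_cmul (repL f) (valL g)

theorem H1.rep_mul (f g : H1) (x : ℝ) : (f.mul g).rep x = f.rep x * g.rep x := by
  have h : (f.mul g).rep = fun x => f.rep x * g.rep x := by
    refine H1.rep_eq_of_ae (f.continuous_rep.mul g.continuous_rep) ?_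
    filter_upwards [f.fn_mul g, g.fn_ae_rep] with x h1 h2
    rw [h1, h2]
  rw [h]

/-! ### The periodic Hilbert transform on `H¹` -/

theorem real_cot_eq (x : ℝ) : Real.cot x = Real.cos x / Real.sin x := Real.cot_eq_cos_div_sin x

theorem real_cot_neg (x : ℝ) : Real.cot (-x) = -Real.cot x := by
  rw [real_cot_eq, real_cot_eq, Real.cos_neg, Real.sin_neg, div_neg]

theorem measurable_cot_half : Measurable fun s : ℝ => Real.cot (s / 2) := by
  simp only [real_cot_eq]
  fun_prop

theorem continuousOn_cot_half : ContinuousOn (fun s : ℝ => Real.cot (s / 2)) (Ioo 0 (2 * Real.pi)) := by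
  simp only [real_cot_eq]
  refine ContinuousOn.div (by fun_prop) (by fun_prop) fun s hs => ?_
  exact (Real.sin_pos_of_pos_of_lt_pi (by linarith [hs.1]) (by linarith [hs.2])).ne'

theorem cot_half_nonneg {s : ℝ} (hs : s ∈ Ioc 0 Real.pi) : 0 ≤ Real.cot (s / 2) := by
  rw [real_cot_eq]
  have := Real.pi_pos
  exact div_nonneg (Real.cos_nonneg_of_mem_Icc ⟨by linarith [hs.1], by linarith [hs.2]⟩)
    (Real.sin_nonneg_of_nonneg_of_le_pi (by linarith [hs.1]) (by linarith [hs.2]))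

/-- This is t < tan t at t = s/2. The endpoint s = π is treated apart, since the cosine vanishes
there. -/
theorem cot_half_le {s : ℝ} (hs : s ∈ Ioc 0 Real.pi) : Real.cot (s / 2) ≤ 2 / s := by
  rw [real_cot_eq]
  have hsin : 0 < Real.sin (s / 2) :=
    Real.sin_pos_of_pos_of_lt_pi (by linarith [hs.1]) (by linarith [hs.2, Real.pi_pos])
  rw [div_le_div_iff₀ hsin hs.1]
  rcases hs.2.lt_or_eq with h | h
  · have hc : 0 < Real.cos (s / 2) :=
      Real.cos_pos_of_mem_Ioo ⟨by linarith [hs.1], by linarith⟩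
    have := Real.lt_tan (x := s / 2) (by linarith [hs.1]) (by linarith)
    rw [Real.tan_eq_sin_div_cos, lt_div_iff₀ hc] at this
    linarith
  · rw [h, Real.cos_pi_div_two, Real.sin_pi_div_two]
    norm_num

/-- The folded integrand of the periodic Hilbert transform. -/
noncomputable def hilbertIntegrand (F : ℝ → ℝ) (x s : ℝ) : ℝ :=
  (F (x - s) - F (x + s)) * Real.cot (s / 2)

/-- Hölder-1/2 continuity gains √s against the singularity 2/s of the cotangent. The resulting
s^(-1/2) is integrable, so the principal value becomes an absolutely convergent integral. -/
theorem H1.abs_hilbertIntegrand_le (f : H1) (x : ℝ) {s : ℝ} (hs : s ∈ Ioc 0 Real.pi) :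
    |hilbertIntegrand f.rep x s| ≤ 2 * √2 * ‖f‖ * s ^ (-(1 / 2) : ℝ) := by
  have h0 : |x - s - (x + s)| = 2 * s := by
    rw [show x - s - (x + s) = -(2 * s) by ring, abs_neg, abs_of_pos (by linarith [hs.1])]
  have h1 : |f.rep (x - s) - f.rep (x + s)| ≤ √(2 * s) * ‖f‖ := by
    have := f.abs_rep_sub_rep_le (x := x + s) (y := x - s) (by rw [h0]; linarith [hs.2])
    rwa [h0] at this
  rw [hilbertIntegrand, abs_mul, abs_of_nonneg (cot_half_nonneg hs)]
  refine (mul_le_mul h1 (cot_half_le hs) (cot_half_nonneg hs) (by positivity)).trans_eq ?_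
  rw [Real.rpow_neg hs.1.le, ← Real.sqrt_eq_rpow, Real.sqrt_mul (by norm_num)]
  have h2 : s = √s * √s := (Real.mul_self_sqrt hs.1.le).symm
  have h3 : √s ≠ 0 := (Real.sqrt_pos.2 hs.1).ne'
  have h4 : (2 : ℝ) / s = 2 * ((√s)⁻¹ * (√s)⁻¹) := by
    rw [← mul_inv, ← h2, div_eq_mul_inv]
  rw [h4]
  field_simp

theorem measurable_hilbertIntegrand {F : ℝ → ℝ} (hF : Continuous F) (x : ℝ) :
    Measurable (hilbertIntegrand F x) := by
  refine Measurable.mul ?_ measurable_cot_half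
  exact (by fun_prop : Continuous fun s => F (x - s) - F (x + s)).measurable

theorem intervalIntegrable_rpow_neg_half (a b : ℝ) :
    IntervalIntegrable (fun s : ℝ => s ^ (-(1 / 2) : ℝ)) volume a b :=
  intervalIntegral.intervalIntegrable_rpow' (by norm_num)

theorem H1.intervalIntegrable_hilbertIntegrand (f : H1) (x : ℝ) :
    IntervalIntegrable (hilbertIntegrand f.rep x) volume 0 Real.pi := by
  refine ((intervalIntegrable_rpow_neg_half 0 Real.pi).const_mul (2 * √2 * ‖f‖)).mono_fun
    (measurable_hilbertIntegrand f.continuous_rep x).aestronglyMeasurable ?_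
  rw [uIoc_of_le Real.pi_pos.le]
  filter_upwards [ae_restrict_mem measurableSet_Ioc] with s hs
  rw [Real.norm_eq_abs]
  exact (f.abs_hilbertIntegrand_le x hs).trans (le_abs_self _)

theorem H1.abs_integral_hilbertIntegrand_le (f : H1) (x : ℝ) {ε : ℝ} (hε : 0 ≤ ε)
    (hεπ : ε ≤ Real.pi) :
    |∫ s in ε..Real.pi, hilbertIntegrand f.rep x s|
      ≤ 2 * √2 * (∫ s in (0 : ℝ)..Real.pi, s ^ (-(1 / 2) : ℝ)) * ‖f‖ := by
  have h1 : |∫ s in ε..Real.pi, hilbertIntegrand f.rep x s|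
      ≤ ∫ s in ε..Real.pi, 2 * √2 * ‖f‖ * s ^ (-(1 / 2) : ℝ) := by
    rw [← Real.norm_eq_abs]
    refine intervalIntegral.norm_integral_le_of_norm_le hεπ
      (Eventually.of_forall fun s hs => ?_)
      ((intervalIntegrable_rpow_neg_half _ _).const_mul _)
    exact f.abs_hilbertIntegrand_le x ⟨hε.trans_lt hs.1, hs.2⟩
  rw [intervalIntegral.integral_const_mul] at h1
  have h2 : ∫ s in ε..Real.pi, s ^ (-(1 / 2) : ℝ) ≤ ∫ s in (0 : ℝ)..Real.pi, s ^ (-(1 / 2) : ℝ) := by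
    refine intervalIntegral.integral_mono_interval hε hεπ le_rfl ?_
      (intervalIntegrable_rpow_neg_half _ _)
    filter_upwards [ae_restrict_mem measurableSet_Ioc] with s hs
    exact Real.rpow_nonneg hs.1.le _
  refine h1.trans ?_
  have h3 := mul_le_mul_of_nonneg_left h2 (by positivity : 0 ≤ 2 * √2 * ‖f‖)
  linarith

/-- The value at `x` of the Hilbert transform of an element of `H¹`. -/
noncomputable def hilbertEval (x : ℝ) : H1 →L[ℝ] ℝ :=
  LinearMap.mkContinuous
    { toFun := fun f => 1 / (2 * Real.pi) * ∫ s in (0 : ℝ)..Real.pi, hilbertIntegrand f.rep x s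
      map_add' := fun f g => by
        rw [← mul_add, ← intervalIntegral.integral_add (f.intervalIntegrable_hilbertIntegrand x)
          (g.intervalIntegrable_hilbertIntegrand x)]
        congr 1
        refine intervalIntegral.integral_congr fun s _ => ?_
        simp only [hilbertIntegrand, H1.rep_add]
        ring
      map_smul' := fun c f => by
        have h : ∫ s in (0 : ℝ)..Real.pi, hilbertIntegrand (c • f).rep x s
            = c * ∫ s in (0 : ℝ)..Real.pi, hilbertIntegrand f.rep x s := by
          rw [← intervalIntegral.integral_const_mul]
          refine intervalIntegral.integral_congr fun s _ => ?_
          simp only [hilbertIntegrand, H1.rep_smul]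
          ring
        rw [RingHom.id_apply, smul_eq_mul, h, mul_left_comm] }
    (1 / (2 * Real.pi) * (2 * √2 * (∫ s in (0 : ℝ)..Real.pi, s ^ (-(1 / 2) : ℝ)))) (fun f => by
      change |1 / (2 * Real.pi) * _| ≤ _
      rw [abs_mul, abs_of_pos (by have := Real.pi_pos; positivity), mul_assoc]
      refine mul_le_mul_of_nonneg_left ?_ (by have := Real.pi_pos; positivity)
      exact f.abs_integral_hilbertIntegrand_le x le_rfl Real.pi_pos.le)

theorem hilbertEval_apply (x : ℝ) (f : H1) : hilbertEval x f
    = 1 / (2 * Real.pi) * ∫ s in (0 : ℝ)..Real.pi, hilbertIntegrand f.rep x s := rfl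

theorem truncHilbert_congr {f g : ℝ → ℝ} (h : f =ᵐ[volume] g) (ε x : ℝ) :
    truncHilbert f ε x = truncHilbert g ε x := by
  rw [truncHilbert, truncHilbert]
  congr 1
  refine integral_congr_ae (ae_restrict_of_ae ?_)
  filter_upwards [h] with y hy
  rw [hy]

theorem norm_coe_of_abs_le_pi {s : ℝ} (hs : |s| ≤ Real.pi) :
    ‖(s : AddCircle (2 * Real.pi))‖ = |s| := by
  rw [AddCircle.norm_coe_eq_abs_iff _ Real.two_pi_pos.ne', abs_of_pos Real.two_pi_pos]
  linarith

/-- The integrand is 2π-periodic, so the period may be centred at x. There the removed set is |s| ≤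
ε, and oddness of the cotangent folds the left half onto the right. -/
theorem truncHilbert_eq {F : ℝ → ℝ} (hF : Continuous F)
    (hp : Function.Periodic F (2 * Real.pi)) {ε : ℝ} (hε : 0 < ε) (hεπ : ε ≤ Real.pi) (x : ℝ) :
    truncHilbert F ε x = 1 / (2 * Real.pi) * ∫ s in ε..Real.pi, hilbertIntegrand F x s := by
  have hpi := Real.pi_pos
  set S : Set ℝ := {y : ℝ | ε < ‖((x - y : ℝ) : AddCircle (2 * Real.pi))‖} with hS
  have hSm : MeasurableSet S := by
    refine (isOpen_lt continuous_const ?_).measurableSet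
    exact continuous_norm.comp ((AddCircle.continuous_mk' _).comp (by fun_prop))
  set k : ℝ → ℝ := S.indicator fun y => F y * Real.cot ((x - y) / 2) with hk
  have hkp : Function.Periodic k (2 * Real.pi) := by
    intro y
    have e1 : (y + 2 * Real.pi ∈ S) ↔ y ∈ S := by
      rw [hS, mem_ofPred_eq, mem_ofPred_eq, ← sub_sub, AddCircle.coe_sub, AddCircle.coe_period,
        sub_zero]
    have e2 : Real.cot ((x - (y + 2 * Real.pi)) / 2) = Real.cot ((x - y) / 2) := by
      rw [show (x - (y + 2 * Real.pi)) / 2 = (x - y) / 2 - Real.pi by ring, real_cot_eq,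
        real_cot_eq, Real.cos_sub_pi, Real.sin_sub_pi, neg_div_neg_eq]
    simp only [hk, indicator, e1, e2, hp y]
  have h1 : truncHilbert F ε x = 1 / (2 * Real.pi) * ∫ y in (0 : ℝ)..(2 * Real.pi), k y := by
    rw [truncHilbert, intervalIntegral.integral_of_le Real.two_pi_pos.le, hk,
      setIntegral_indicator hSm]
    rfl
  have h2 : ∫ y in (0 : ℝ)..(2 * Real.pi), k y = ∫ s in (-Real.pi)..Real.pi, k (x - s) := by
    rw [intervalIntegral.integral_comp_sub_left, sub_neg_eq_add]
    have := hkp.intervalIntegral_add_eq 0 (x - Real.pi)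
    rw [zero_add] at this
    rw [this]
    congr 1
    ring
  have hcot : ContinuousOn (fun s : ℝ => Real.cot (s / 2)) (Icc ε Real.pi) :=
    continuousOn_cot_half.mono fun s hs => ⟨hε.trans_le hs.1, by linarith [hs.2]⟩
  have hA : IntervalIntegrable (fun s => F (x - s) * Real.cot (s / 2)) volume ε Real.pi := by
    refine ContinuousOn.intervalIntegrable_of_Icc hεπ (ContinuousOn.mul ?_ hcot)
    fun_prop
  have hB : IntervalIntegrable (fun s => F (x + s) * Real.cot (s / 2)) volume ε Real.pi := by
    refine ContinuousOn.intervalIntegrable_of_Icc hεπ (ContinuousOn.mul ?_ hcot)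
    fun_prop
  have hC : IntervalIntegrable (fun s => F (x - s) * Real.cot (s / 2)) volume (-Real.pi) (-ε) := by
    have h := ((IntervalIntegrable.iff_comp_neg (by exact enorm_ne_top)).1 hB.neg).symm
    refine h.congr ?_
    refine fun s _ => ?_
    simp only [Pi.neg_apply, neg_div, real_cot_neg]
    rw [sub_eq_add_neg]
    ring
  have kin : ∀ s, |s| ≤ Real.pi → ε < |s| → k (x - s) = F (x - s) * Real.cot (s / 2) := by
    intro s h1 h2
    have : x - s ∈ S := by
      rw [hS, mem_ofPred_eq, sub_sub_cancel, norm_coe_of_abs_le_pi h1]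
      exact h2
    rw [hk, indicator_of_mem this, sub_sub_cancel]
  have kout : ∀ s, |s| ≤ ε → k (x - s) = 0 := by
    intro s h1
    have : x - s ∉ S := by
      rw [hS, mem_ofPred_eq, sub_sub_cancel, norm_coe_of_abs_le_pi (h1.trans hεπ)]
      exact h1.not_gt
    rw [hk, indicator_of_notMem this]
  have i1 : ∀ᵐ s : ℝ, s ∈ uIoc (-Real.pi) (-ε) → F (x - s) * Real.cot (s / 2) = k (x - s) := by
    -- The endpoint -ε lies in the half-open interval but not in the truncated region, which is
    -- defined by a strict inequality.
    have : ∀ᵐ s : ℝ, s ≠ -ε := by simp [ae_iff]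
    filter_upwards [this] with s hne hs
    rw [uIoc_of_le (by linarith)] at hs
    have h3 : s < -ε := lt_of_le_of_ne hs.2 hne
    have h4 : |s| = -s := abs_of_neg (by linarith)
    exact (kin s (by rw [h4]; linarith [hs.1]) (by rw [h4]; linarith)).symm
  have i2 : ∀ᵐ s : ℝ, s ∈ uIoc (-ε) ε → (fun _ => (0 : ℝ)) s = k (x - s) := by
    refine Eventually.of_forall fun s hs => ?_
    rw [uIoc_of_le (by linarith)] at hs
    exact (kout s (abs_le.2 ⟨hs.1.le, hs.2⟩)).symm
  have i3 : ∀ᵐ s : ℝ, s ∈ uIoc ε Real.pi → F (x - s) * Real.cot (s / 2) = k (x - s) := by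
    refine Eventually.of_forall fun s hs => ?_
    rw [uIoc_of_le hεπ] at hs
    have h4 : |s| = s := abs_of_pos (by linarith [hs.1])
    exact (kin s (by rw [h4]; exact hs.2) (by rw [h4]; exact hs.1)).symm
  have j1 : IntervalIntegrable (fun s => k (x - s)) volume (-Real.pi) (-ε) :=
    hC.congr_ae ((ae_restrict_iff' measurableSet_uIoc).2 i1)
  have j2 : IntervalIntegrable (fun s => k (x - s)) volume (-ε) ε :=
    (intervalIntegrable_const (c := (0 : ℝ))).congr_ae ((ae_restrict_iff' measurableSet_uIoc).2 i2)
  have j3 : IntervalIntegrable (fun s => k (x - s)) volume ε Real.pi :=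
    hA.congr_ae ((ae_restrict_iff' measurableSet_uIoc).2 i3)
  have hneg : ∫ s in (-Real.pi)..(-ε), F (x - s) * Real.cot (s / 2)
      = -∫ s in ε..Real.pi, F (x + s) * Real.cot (s / 2) := by
    rw [← intervalIntegral.integral_comp_neg, ← intervalIntegral.integral_neg]
    refine intervalIntegral.integral_congr fun s _ => ?_
    simp only [neg_div, real_cot_neg, sub_neg_eq_add]
    ring
  rw [h1, h2, ← intervalIntegral.integral_add_adjacent_intervals (j1.trans j2) j3,
    ← intervalIntegral.integral_add_adjacent_intervals j1 j2,
    ← intervalIntegral.integral_congr_ae i1, ← intervalIntegral.integral_congr_ae i2,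
    ← intervalIntegral.integral_congr_ae i3, hneg, intervalIntegral.integral_zero, add_zero,
    neg_add_eq_sub, ← intervalIntegral.integral_sub hA hB]
  congr 1
  refine intervalIntegral.integral_congr fun s _ => ?_
  simp only [hilbertIntegrand]
  ring

/-- The folded integrand is integrable up to 0, so the limit is continuity of its primitive; it
exists at every x. -/
theorem H1.tendsto_truncHilbert (f : H1) (x : ℝ) :
    Tendsto (fun ε => truncHilbert f.rep ε x) (𝓝[>] 0) (𝓝 (hilbertEval x f)) := by
  have hpi := Real.pi_pos
  have hc := intervalIntegral.continuousOn_primitive_interval'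
    (f.intervalIntegrable_hilbertIntegrand x) (right_mem_uIcc (a := 0) (b := Real.pi))
  have h1 : Tendsto (fun ε => ∫ s in Real.pi..ε, hilbertIntegrand f.rep x s) (𝓝[>] 0)
      (𝓝 (∫ s in Real.pi..0, hilbertIntegrand f.rep x s)) := by
    have h2 := hc 0 left_mem_uIcc
    rw [uIcc_of_le hpi.le] at h2
    refine h2.tendsto.mono_left ?_
    rw [← nhdsWithin_Ioc_eq_nhdsGT hpi]
    exact nhdsWithin_mono _ Ioc_subset_Icc_self
  have h3 := (h1.neg).const_mul (1 / (2 * Real.pi))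
  rw [← intervalIntegral.integral_symm, ← hilbertEval_apply] at h3
  refine h3.congr' ?_
  filter_upwards [Ioc_mem_nhdsGT hpi] with ε hε
  rw [← intervalIntegral.integral_symm, truncHilbert_eq f.continuous_rep f.rep_periodic hε.1 hε.2]

/-! ### The Hilbert transform on the trigonometric system -/

theorem sin_mul_cos_half (n : ℕ) (s : ℝ) :
    Real.sin (n * s) * Real.cos (s / 2)
      = (∑ k ∈ Finset.range n, (Real.cos ((k + 1 : ℕ) * s) + Real.cos (k * s)))
        * Real.sin (s / 2) := by
  induction n with
  | zero => simp
  | succ n ih =>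
    rw [Finset.sum_range_succ, add_mul, ← ih]
    have h1 : ((n + 1 : ℕ) : ℝ) * s = n * s + 2 * (s / 2) := by push_cast; ring
    rw [h1, Real.sin_add, Real.cos_add, Real.sin_two_mul, Real.cos_two_mul]
    have h2 := Real.sin_sq_add_cos_sq (s / 2)
    have h3 : Real.cos (s / 2) ^ 2 = 1 - Real.sin (s / 2) ^ 2 := by linarith
    ring_nf
    rw [show Real.cos (s * (1 / 2)) ^ 3
      = Real.cos (s * (1 / 2)) * Real.cos (s * (1 / 2)) ^ 2 by ring,
      show s * (1 / 2) = s / 2 by ring, h3]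
    ring

theorem integral_cos_nat_mul_pi (k : ℕ) :
    ∫ s in (0 : ℝ)..Real.pi, Real.cos (k * s) = if k = 0 then Real.pi else 0 := by
  split_ifs with h
  · simp [h]
  · have hk : (k : ℝ) ≠ 0 := Nat.cast_ne_zero.2 h
    rw [intervalIntegral.integral_comp_mul_left (fun x => Real.cos x) hk, integral_cos]
    simp [Real.sin_nat_mul_pi]

/-- The integrand is a finite sum of cosines, as in the Dirichlet kernel. Only the zero frequency
survives integration, and it occurs exactly once when n ≥ 1. -/
theorem integral_sin_nat_mul_cot (n : ℕ) :
    ∫ s in (0 : ℝ)..Real.pi, Real.sin (n * s) * Real.cot (s / 2)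
      = if n = 0 then 0 else Real.pi := by
  have h1 : ∫ s in (0 : ℝ)..Real.pi, Real.sin (n * s) * Real.cot (s / 2)
      = ∫ s in (0 : ℝ)..Real.pi,
        ∑ k ∈ Finset.range n, (Real.cos ((k + 1 : ℕ) * s) + Real.cos (k * s)) := by
    refine intervalIntegral.integral_congr_ae (Eventually.of_forall fun s hs => ?_)
    rw [uIoc_of_le Real.pi_pos.le] at hs
    have hsin : Real.sin (s / 2) ≠ 0 :=
      (Real.sin_pos_of_pos_of_lt_pi (by linarith [hs.1]) (by linarith [hs.2, Real.pi_pos])).ne'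
    rw [real_cot_eq, ← mul_div_assoc, sin_mul_cos_half, mul_div_assoc, div_self hsin, mul_one]
  have h2 : ∀ k : ℕ, Continuous fun s : ℝ => Real.cos ((k + 1 : ℕ) * s) + Real.cos (k * s) :=
    fun k => by fun_prop
  rw [h1, intervalIntegral.integral_finsetSum fun k _ => (h2 k).intervalIntegrable _ _]
  have h3 : ∀ k : ℕ, ∫ s in (0 : ℝ)..Real.pi, (Real.cos ((k + 1 : ℕ) * s) + Real.cos (k * s))
      = if k = 0 then Real.pi else 0 := by
    intro k
    rw [intervalIntegral.integral_add
      ((by fun_prop : Continuous fun s : ℝ => Real.cos ((k + 1 : ℕ) * s)).intervalIntegrable _ _)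
      ((by fun_prop : Continuous fun s : ℝ => Real.cos (k * s)).intervalIntegrable _ _),
      integral_cos_nat_mul_pi, integral_cos_nat_mul_pi, if_neg (Nat.succ_ne_zero k), zero_add]
  simp only [h3]
  rw [Finset.sum_ite_eq']
  simp only [Finset.mem_range, Nat.pos_iff_ne_zero]
  split_ifs <;> simp_all

theorem integral_sin_int_mul_cot (n : ℤ) :
    ∫ s in (0 : ℝ)..Real.pi, Real.sin (n * s) * Real.cot (s / 2) = n.sign * Real.pi := by
  have hn : ∀ m : ℕ, ∫ s in (0 : ℝ)..Real.pi, Real.sin ((m : ℤ) * s) * Real.cot (s / 2)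
      = (m : ℤ).sign * Real.pi := by
    intro m
    have h := integral_sin_nat_mul_cot m
    simp only [Int.cast_natCast]
    rw [h]
    split_ifs with h0
    · simp [h0]
    · rw [Int.sign_natCast_of_ne_zero h0]; simp
  obtain ⟨m, rfl | rfl⟩ := n.eq_nat_or_neg
  · exact hn m
  · have h := hn m
    have e : ((-(m : ℤ)).sign : ℝ) = -((m : ℤ).sign : ℝ) := by rw [Int.sign_neg, Int.cast_neg]
    rw [e, neg_mul, ← h, ← intervalIntegral.integral_neg]
    refine intervalIntegral.integral_congr fun s _ => ?_
    simp only [Int.cast_neg, neg_mul, Real.sin_neg]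

/-- The symmetric difference of `cas n` at x is -2 `cas (-n)` x sin(ns), which separates the
variables. -/
theorem hilbertEval_casH1 (n : ℤ) (x : ℝ) :
    hilbertEval x (casH1 n) = -n.sign * cas (-n) x := by
  have h : ∫ s in (0 : ℝ)..Real.pi, hilbertIntegrand (casH1 n).rep x s
      = (-2 * cas (-n) x) * ∫ s in (0 : ℝ)..Real.pi, Real.sin (n * s) * Real.cot (s / 2) := by
    rw [← intervalIntegral.integral_const_mul]
    refine intervalIntegral.integral_congr fun s _ => ?_
    simp only [hilbertIntegrand, rep_casH1, cas, Int.cast_neg, neg_mul, Real.cos_neg, Real.sin_neg,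
      mul_sub, mul_add, Real.cos_sub, Real.cos_add, Real.sin_sub, Real.sin_add]
    ring
  rw [hilbertEval_apply, h, integral_sin_int_mul_cot]
  have := Real.pi_ne_zero
  field_simp

theorem norm_casH1_neg (n : ℤ) : ‖casH1 (-n)‖ = ‖casH1 n‖ := by
  rw [norm_casH1, norm_casH1]
  simp

theorem H1.inner_smul_smul (a b : ℝ) (f g : H1) :
    inner ℝ (a • f) (b • g) = a * (b * inner ℝ f g) :=
  (real_inner_smul_left f (b • g) a).trans (congrArg (a * ·) (real_inner_smul_right f g b))

theorem orthonormal_casH1 : Orthonormal ℝ fun n => ‖casH1 n‖⁻¹ • casH1 n := by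
  refine ⟨fun n => ?_, fun n m hnm => ?_⟩
  · rw [norm_smul, norm_inv, norm_norm, inv_mul_cancel₀ (norm_casH1_pos n).ne']
  · change inner ℝ (‖casH1 n‖⁻¹ • casH1 n) (‖casH1 m‖⁻¹ • casH1 m) = 0
    rw [H1.inner_smul_smul, inner_casH1, if_neg hnm, mul_zero, mul_zero]

/-- The sign by which `reflectH1` multiplies the reflected frequency. -/
def reflectSign (n : ℤ) : ℝ := if 0 < n then -1 else 1

theorem orthonormal_reflect :
    Orthonormal ℝ fun n => reflectSign n • (‖casH1 (-n)‖⁻¹ • casH1 (-n)) := by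
  have h := orthonormal_casH1.comp _ neg_injective
  refine ⟨fun n => ?_, fun n m hnm => ?_⟩
  · have h1 := h.1 n
    simp only [Function.comp_apply] at h1
    rw [norm_smul, h1, mul_one, reflectSign]
    split_ifs <;> simp
  · have h1 := h.2 hnm
    simp only [Function.comp_apply] at h1
    change inner ℝ (reflectSign n • (‖casH1 (-n)‖⁻¹ • casH1 (-n)))
      (reflectSign m • (‖casH1 (-m)‖⁻¹ • casH1 (-m))) = 0
    rw [H1.inner_smul_smul, h1, mul_zero, mul_zero]

theorem span_normalized_casH1 :
    (⊤ : Submodule ℝ H1) ≤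
      (Submodule.span ℝ (range fun n => ‖casH1 n‖⁻¹ • casH1 n)).topologicalClosure := by
  rw [← span_casH1_topologicalClosure]
  refine Submodule.topologicalClosure_mono (Submodule.span_le.2 ?_)
  rintro _ ⟨n, rfl⟩
  have h : casH1 n = ‖casH1 n‖ • (‖casH1 n‖⁻¹ • casH1 n) := by
    rw [smul_smul, mul_inv_cancel₀ (norm_casH1_pos n).ne', one_smul]
  rw [h]
  exact Submodule.smul_mem _ _ (Submodule.subset_span ⟨n, rfl⟩)

/-- The orthonormal basis of `H¹` made of the normalized functions `cas n`. -/
noncomputable def casBasis : HilbertBasis ℤ ℝ H1 :=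
  HilbertBasis.mk orthonormal_casH1 span_normalized_casH1

/-- The isometry of `H¹` sending `cas n` to `reflectSign n * cas (-n)`. -/
noncomputable def reflectH1 : H1 →ₗᵢ[ℝ] H1 :=
  (orthonormal_reflect.orthogonalFamily.linearIsometry).comp casBasis.repr.toLinearIsometry

theorem reflectH1_casH1 (n : ℤ) : reflectH1 (casH1 n) = reflectSign n • casH1 (-n) := by
  have hb : casBasis n = ‖casH1 n‖⁻¹ • casH1 n := by
    rw [casBasis, HilbertBasis.coe_mk]
  have h : casH1 n = ‖casH1 n‖ • casBasis n := by
    rw [hb, smul_smul, mul_inv_cancel₀ (norm_casH1_pos n).ne', one_smul]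
  have h2 : reflectH1 (casBasis n) = reflectSign n • (‖casH1 (-n)‖⁻¹ • casH1 (-n)) := by
    change orthonormal_reflect.orthogonalFamily.linearIsometry (casBasis.repr (casBasis n)) = _
    rw [HilbertBasis.repr_self, OrthogonalFamily.linearIsometry_apply_single]
    simp
  rw [h, map_smul, h2, norm_casH1_neg, smul_comm ‖casH1 n‖, smul_smul ‖casH1 n‖,
    mul_inv_cancel₀ (norm_casH1_pos n).ne', one_smul]

/-- The periodic Hilbert transform as a bounded operator on `H¹`. -/
noncomputable def hilbertL : H1 →L[ℝ] H1 :=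
  reflectH1.toContinuousLinearMap
    - (1 / (2 * Real.pi)) • (innerSL ℝ (casH1 0)).smulRight (casH1 0)

theorem hilbertL_apply (f : H1) :
    hilbertL f = reflectH1 f - (1 / (2 * Real.pi)) • (inner ℝ (casH1 0) f • casH1 0) := rfl

/-- The reflection isometry has the right sign at every nonzero frequency but fixes the constants.
The rank-one term, with 2π = ‖`casH1 0`‖², removes them. -/
theorem hilbertL_casH1 (n : ℤ) : hilbertL (casH1 n) = (-n.sign : ℝ) • casH1 (-n) := by
  have := Real.pi_ne_zero
  rw [hilbertL_apply, reflectH1_casH1, inner_casH1]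
  rcases lt_trichotomy n 0 with h | h | h
  · rw [if_neg h.ne', Int.sign_eq_neg_one_of_neg h, reflectSign, if_neg h.not_gt]
    simp
  · subst h
    rw [if_pos rfl, reflectSign, if_neg (lt_irrefl _), smul_smul]
    have : 1 / (2 * Real.pi) * (2 * Real.pi * (1 + ((0 : ℤ) : ℝ) ^ 2)) = 1 := by
      simp only [Int.cast_zero]
      field_simp
      norm_num
    rw [this]
    simp
  · rw [if_neg h.ne, Int.sign_eq_one_of_pos h, reflectSign, if_pos h]
    simp

/-- Evaluation at x after `hilbertL` and the folded integral are both continuous functionals on H¹,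
so agreement on the trigonometric system suffices. -/
theorem rep_hilbertL (f : H1) (x : ℝ) : (hilbertL f).rep x = hilbertEval x f := by
  have h : (evL x).comp hilbertL = hilbertEval x := by
    refine H1.clm_ext fun n => ?_
    rw [ContinuousLinearMap.comp_apply, hilbertL_casH1, map_smul, evL_apply, rep_casH1,
      hilbertEval_casH1, smul_eq_mul]
  exact DFunLike.congr_fun h f

theorem isHilbertTransform_hilbertL {f : ℝ → ℝ} {F : H1} (h : f =ᵐ[volume] F.rep) :
    IsHilbertTransform f (hilbertL F).fn := by
  filter_upwards [(hilbertL F).fn_ae_rep] with x hx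
  rw [hx, rep_hilbertL]
  simp only [truncHilbert_congr h]
  exact F.tendsto_truncHilbert x

theorem eq_hilbertL_of_isHilbertTransform {f : ℝ → ℝ} {F G : H1} (h : f =ᵐ[volume] F.rep)
    (hG : IsHilbertTransform f G.fn) : G = hilbertL F := by
  refine H1.ext_fn ?_
  filter_upwards [hG, isHilbertTransform_hilbertL h] with x h1 h2
  exact tendsto_nhds_unique h1 h2

theorem H1.sq_fn_ae (u : H1) : (fun x => u.fn x ^ 2) =ᵐ[volume] (u.mul u).rep := by
  filter_upwards [u.fn_ae_rep] with x hx
  rw [hx, H1.rep_mul, sq]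

/-! ### Maximal solutions of autonomous differential equations -/

section Autonomous

variable {E : Type*} [NormedAddCommGroup E] [NormedSpace ℝ E]

/-- `γ` solves `γ' = Φ(γ)`, `γ(0) = x₀` on `[0,T)`. -/
structure IsFlowLine (Φ : E → E) (x₀ : E) (T : ℝ) (γ : ℝ → E) : Prop where
  init : γ 0 = x₀
  deriv : ∀ t ∈ Ico 0 T, HasDerivWithinAt γ (Φ (γ t)) (Ico 0 T) t

variable {Φ : E → E} {x₀ : E} {T S : ℝ} {γ η : ℝ → E}

theorem IsFlowLine.continuousOn (h : IsFlowLine Φ x₀ T γ) : ContinuousOn γ (Ico 0 T) :=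
  fun t ht => (h.deriv t ht).continuousWithinAt

theorem IsFlowLine.mono (h : IsFlowLine Φ x₀ T γ) (hS : S ≤ T) : IsFlowLine Φ x₀ S γ :=
  ⟨h.init, fun t ht => (h.deriv t ⟨ht.1, ht.2.trans_le hS⟩).mono (Ico_subset_Ico_right hS)⟩

theorem IsFlowLine.hasDerivWithinAt_Ici (h : IsFlowLine Φ x₀ T γ) {t : ℝ} (ht : t ∈ Ico 0 T) :
    HasDerivWithinAt γ (Φ (γ t)) (Ici t) t := by
  refine (h.deriv t ht).mono_of_mem_nhdsWithin ?_
  refine mem_of_superset (Ico_mem_nhdsGE ht.2) ?_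
  exact Ico_subset_Ico_left ht.1

/-- On a compact time interval both curves stay in a common ball, where Φ is Lipschitz and the
Grönwall uniqueness theorem applies. -/
theorem IsFlowLine.eqOn (hΦ : ∀ R : ℝ, ∃ K, LipschitzOnWith K Φ (Metric.closedBall 0 R))
    (h : IsFlowLine Φ x₀ T γ) (h' : IsFlowLine Φ x₀ S η) :
    EqOn γ η (Ico 0 (min T S)) := by
  intro t ht
  have h1 := h.mono (min_le_left T S)
  have h2 := h'.mono (min_le_right T S)
  have hsub : Icc 0 t ⊆ Ico 0 (min T S) := fun s hs => ⟨hs.1, hs.2.trans_lt ht.2⟩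
  obtain ⟨R₁, hR₁⟩ := isCompact_Icc.exists_bound_of_continuousOn (h1.continuousOn.mono hsub)
  obtain ⟨R₂, hR₂⟩ := isCompact_Icc.exists_bound_of_continuousOn (h2.continuousOn.mono hsub)
  obtain ⟨K, hK⟩ := hΦ (max R₁ R₂)
  refine ODE_solution_unique_of_mem_Icc_right (v := fun _ => Φ) (K := K)
    (s := fun _ => Metric.closedBall 0 (max R₁ R₂)) (fun _ _ => hK)
    (h1.continuousOn.mono hsub)
    (fun s hs => h1.hasDerivWithinAt_Ici (hsub (Ico_subset_Icc_self hs)))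
    (fun s hs => ?_) (h2.continuousOn.mono hsub)
    (fun s hs => h2.hasDerivWithinAt_Ici (hsub (Ico_subset_Icc_self hs)))
    (fun s hs => ?_) (h1.init.trans h2.init.symm) (right_mem_Icc.2 ht.1)
  · rw [mem_closedBall_zero_iff]
    exact (hR₁ s (Ico_subset_Icc_self hs)).trans (le_max_left _ _)
  · rw [mem_closedBall_zero_iff]
    exact (hR₂ s (Ico_subset_Icc_self hs)).trans (le_max_right _ _)

/-- The point is that the existence time depends only on the norm of the initial value; this forces
the norm to blow up at the end of the maximal interval. -/
theorem exists_isFlowLine_uniform [CompleteSpace E]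
    (hΦ : ∀ R : ℝ, ∃ K, LipschitzOnWith K Φ (Metric.closedBall 0 R)) (R : ℝ) (hR : 0 ≤ R) :
    ∃ δ > 0, ∀ x : E, ‖x‖ ≤ R → ∃ γ, IsFlowLine Φ x δ γ := by
  obtain ⟨K, hK⟩ := hΦ (R + 1)
  have hb : ∀ x ∈ Metric.closedBall (0 : E) (R + 1), ‖Φ x‖ ≤ ‖Φ 0‖ + K * (R + 1) := by
    intro x hx
    have h1 := hK.norm_sub_le hx (Metric.mem_closedBall_self (by linarith))
    rw [sub_zero] at h1
    rw [mem_closedBall_zero_iff] at hx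
    have h2 : ‖Φ x‖ ≤ ‖Φ 0‖ + ‖Φ x - Φ 0‖ := by
      have := norm_add_le (Φ 0) (Φ x - Φ 0)
      rwa [add_sub_cancel] at this
    have h3 := mul_le_mul_of_nonneg_left hx K.coe_nonneg
    linarith
  set L : ℝ := ‖Φ 0‖ + K * (R + 1) with hL
  have hL0 : 0 ≤ L := by positivity
  have hδ : 0 < 1 / (L + 1) := by positivity
  -- At speed at most L, a curve starting in the ball of radius R moves less than 1 in this time and
  -- stays in the ball of radius R + 1.
  refine ⟨1 / (L + 1), hδ, fun x hx => ?_⟩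
  have hp : IsPicardLindelof (fun _ => Φ) (tmin := 0) (tmax := 1 / (L + 1))
      ⟨0, left_mem_Icc.2 hδ.le⟩ (0 : E) ⟨R + 1, by linarith⟩ ⟨R, hR⟩ ⟨L, hL0⟩ K := by
    refine IsPicardLindelof.of_time_independent hb hK ?_
    change L * max (1 / (L + 1) - 0) (0 - 0) ≤ (R + 1) - R
    rw [sub_zero, sub_zero, max_eq_left hδ.le, mul_one_div, div_le_iff₀ (by positivity)]
    linarith
  obtain ⟨α, h0, hα⟩ := hp.exists_eq_forall_mem_Icc_hasDerivWithinAt (x := x)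
    (by rw [mem_closedBall_zero_iff]; exact hx)
  exact ⟨α, h0, fun t ht => (hα t (Ico_subset_Icc_self ht)).mono Ico_subset_Icc_self⟩

theorem IsFlowLine.glue (h : IsFlowLine Φ x₀ T γ) {s : ℝ} (hs : s ∈ Ico 0 T)
    (h' : IsFlowLine Φ (γ s) S η) : ∃ ζ, IsFlowLine Φ x₀ (s + S) ζ := by
  refine ⟨fun t => if t ≤ s then γ t else η (t - s), ?_, ?_⟩
  · simp only [if_pos hs.1, h.init]
  intro t ht
  set ζ : ℝ → E := fun t => if t ≤ s then γ t else η (t - s) with hζ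
  have e1 : ∀ r ≤ s, ζ r = γ r := fun r hr => if_pos hr
  have e2 : ∀ r, s ≤ r → ζ r = η (r - s) := by
    intro r hr
    rcases hr.eq_or_lt with rfl | hr
    · rw [e1 _ le_rfl, sub_self, h'.init]
    · exact if_neg hr.not_ge
  have left : t ≤ s → HasDerivWithinAt ζ (Φ (ζ t)) (Icc 0 s) t := by
    intro hts
    have h1 := (h.deriv t ⟨ht.1, hts.trans_lt hs.2⟩).mono
      (show Icc 0 s ⊆ Ico 0 T from fun r hr => ⟨hr.1, hr.2.trans_lt hs.2⟩)
    rw [e1 t hts]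
    exact h1.congr (fun r hr => e1 r hr.2) (e1 t hts)
  have right : s ≤ t → HasDerivWithinAt ζ (Φ (ζ t)) (Ico s (s + S)) t := by
    intro hst
    have h1 := h'.deriv (t - s) ⟨sub_nonneg.2 hst, by linarith [ht.2]⟩
    have h2 : HasDerivWithinAt (fun r => η (r - s)) (Φ (η (t - s))) (Ico s (s + S)) t := by
      have h3 : HasDerivWithinAt (fun r : ℝ => r - s) 1 (Ico s (s + S)) t :=
        ((hasDerivAt_id t).sub_const s).hasDerivWithinAt
      have hm : MapsTo (fun r : ℝ => r - s) (Ico s (s + S)) (Ico 0 S) :=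
        fun r hr => ⟨sub_nonneg.2 hr.1, by linarith [hr.2]⟩
      have h4 := h1.scomp t h3 hm
      rwa [one_smul] at h4
    rw [e2 t hst]
    exact h2.congr (fun r hr => e2 r hr.1) (e2 t hst)
  rcases lt_trichotomy t s with h1 | h1 | h1
  · refine (left h1.le).mono_of_mem_nhdsWithin ?_
    refine mem_of_superset (inter_mem_nhdsWithin _ (Iio_mem_nhds h1)) ?_
    exact fun r hr => ⟨hr.1.1, le_of_lt hr.2⟩
  -- At the junction both one-sided derivatives equal Φ of the common value.
  · have h2 := (left h1.le).union (right h1.ge)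
    refine h2.mono fun r hr => ?_
    rcases le_total r s with h3 | h3
    · exact Or.inl ⟨hr.1, h3⟩
    · exact Or.inr ⟨h3, hr.2⟩
  · refine (right h1.le).mono_of_mem_nhdsWithin ?_
    refine mem_of_superset (inter_mem_nhdsWithin _ (Ioi_mem_nhds h1)) ?_
    exact fun r hr => ⟨le_of_lt hr.2, hr.1.2⟩

theorem exists_maximal_isFlowLine [CompleteSpace E]
    (hΦ : ∀ R : ℝ, ∃ K, LipschitzOnWith K Φ (Metric.closedBall 0 R)) (x₀ : E) {B : ℝ}
    (hB : ∀ T γ, 0 < T → IsFlowLine Φ x₀ T γ → T ≤ B) :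
    ∃ T, 0 < T ∧ T ≤ B ∧ ∃ γ, IsFlowLine Φ x₀ T γ ∧
      Tendsto (fun t => ‖γ t‖) (𝓝[<] T) atTop ∧
      ∀ T' η, 0 < T' → IsFlowLine Φ x₀ T' η → T' ≤ T ∧ ∀ t ∈ Ico 0 T', η t = γ t := by
  set A : Set ℝ := {T | 0 < T ∧ ∃ γ, IsFlowLine Φ x₀ T γ} with hA
  have hbdd : BddAbove A := ⟨B, fun T hT => hB T hT.2.choose hT.1 hT.2.choose_spec⟩
  obtain ⟨δ₀, hδ₀, hloc⟩ := exists_isFlowLine_uniform hΦ ‖x₀‖ (norm_nonneg _)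
  have hmem : δ₀ ∈ A := ⟨hδ₀, hloc x₀ le_rfl⟩
  set T := sSup A with hT
  have hTpos : 0 < T := hδ₀.trans_le (le_csSup hbdd hmem)
  have hex : ∀ t < T, ∃ S γ, t < S ∧ S ≤ T ∧ IsFlowLine Φ x₀ S γ := by
    intro t ht
    obtain ⟨S, hS, htS⟩ := exists_lt_of_lt_csSup ⟨δ₀, hmem⟩ ht
    obtain ⟨γ, hγ⟩ := hS.2
    exact ⟨S, γ, htS, le_csSup hbdd hS, hγ⟩
  choose! S Γ hS1 hS2 hS3 using hex
  -- By uniqueness the diagonal t ↦ `Γ t t` does not depend on the chosen curves, so it is the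
  -- maximal solution.
  have hagree : ∀ T' η, IsFlowLine Φ x₀ T' η → ∀ t ∈ Ico 0 T', t < T → η t = Γ t t := by
    intro T' η hη t ht htT
    exact hη.eqOn hΦ (hS3 t htT) ⟨ht.1, lt_min ht.2 (hS1 t htT)⟩
  have hflow : IsFlowLine Φ x₀ T fun t => Γ t t := by
    refine ⟨(hS3 0 hTpos).init, fun t ht => ?_⟩
    have h1 := (hS3 t ht.2).deriv t ⟨ht.1, hS1 t ht.2⟩
    have h2 : HasDerivWithinAt (fun r => Γ r r) (Φ (Γ t t)) (Ico 0 (S t)) t :=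
      h1.congr (fun r hr => (hagree _ _ (hS3 t ht.2) r hr (hr.2.trans_le (hS2 t ht.2))).symm) rfl
    refine h2.mono_of_mem_nhdsWithin ?_
    refine mem_of_superset (inter_mem_nhdsWithin _ (Iio_mem_nhds (hS1 t ht.2))) ?_
    exact fun r hr => ⟨hr.1.1, hr.2⟩
  refine ⟨T, hTpos, hB T _ hTpos hflow, fun t => Γ t t, hflow, ?_, ?_⟩
  · rw [tendsto_atTop]
    intro M
    -- If the norm were below M at a time within δ of T, restarting from there would give a solution
    -- living past the supremum T.
    obtain ⟨δ, hδ, hloc⟩ := exists_isFlowLine_uniform hΦ (max M 0) (le_max_right _ _)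
    filter_upwards [Ioo_mem_nhdsLT (max_lt hTpos (by linarith : T - δ < T))] with t ht
    by_contra hlt
    have h0 : 0 ≤ t := (le_max_left _ _).trans ht.1.le
    obtain ⟨η, hη⟩ := hloc (Γ t t) ((not_le.1 hlt).le.trans (le_max_left _ _))
    obtain ⟨ζ, hζ⟩ := hflow.glue ⟨h0, ht.2⟩ hη
    have h1 : t + δ ≤ T := le_csSup hbdd ⟨by linarith, ζ, hζ⟩
    have h2 : T - δ < t := (le_max_right _ _).trans_lt ht.1
    linarith
  · intro T' η hT' hη
    have h1 : T' ≤ T := le_csSup hbdd ⟨hT', η, hη⟩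
    exact ⟨h1, fun t ht => hagree T' η hη t ht (ht.2.trans_le h1)⟩

end Autonomous

/-! ### The blow-up time of a second order differential inequality -/

/-- The absolute value makes the integrand continuous on the whole line, so its primitive is
differentiable everywhere. -/
theorem continuous_inv_sqrt_abs_cube :
    Continuous fun y : ℝ => 1 / Real.sqrt (|y| ^ 3 + 1) := by
  refine continuous_const.div (by fun_prop) fun y => ?_
  exact (Real.sqrt_pos.2 (by positivity)).ne'

theorem integrableOn_inv_sqrt_abs_cube :
    IntegrableOn (fun y : ℝ => 1 / Real.sqrt (|y| ^ 3 + 1)) (Ioi 0) := by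
  rw [← Ioc_union_Ioi_eq_Ioi zero_le_one, integrableOn_union]
  refine ⟨(continuous_inv_sqrt_abs_cube.integrableOn_Icc).mono_set Ioc_subset_Icc_self, ?_⟩
  have h := integrableOn_Ioi_rpow_of_lt (a := -(3 / 2)) (by norm_num) (zero_lt_one' ℝ)
  refine h.mono' continuous_inv_sqrt_abs_cube.aestronglyMeasurable ?_
  filter_upwards [ae_restrict_mem measurableSet_Ioi] with y hy
  have hy0 : 0 < y := zero_lt_one.trans hy
  rw [Real.norm_eq_abs, abs_of_nonneg (by positivity), abs_of_pos hy0, Real.rpow_neg hy0.le,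
    one_div]
  have h2 : y ^ (3 / 2 : ℝ) = √(y ^ 3) := by
    rw [Real.sqrt_eq_rpow, ← Real.rpow_natCast, ← Real.rpow_mul hy0.le]
    norm_num
  rw [h2]
  exact inv_anti₀ (Real.sqrt_pos.2 (by positivity)) (Real.sqrt_le_sqrt (by linarith))

theorem integral_inv_sqrt_abs_cube_le {z : ℝ} (hz : 0 ≤ z) :
    ∫ y in (0 : ℝ)..z, 1 / Real.sqrt (|y| ^ 3 + 1)
      ≤ ∫ y in Ioi (0 : ℝ), 1 / Real.sqrt (y ^ 3 + 1) := by
  have h : ∫ y in Ioi (0 : ℝ), 1 / Real.sqrt (y ^ 3 + 1)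
      = ∫ y in Ioi (0 : ℝ), 1 / Real.sqrt (|y| ^ 3 + 1) := by
    refine setIntegral_congr_fun measurableSet_Ioi fun y hy => ?_
    simp only [abs_of_pos (mem_Ioi.1 hy)]
  rw [h, intervalIntegral.integral_of_le hz]
  refine setIntegral_mono_set integrableOn_inv_sqrt_abs_cube
    (Eventually.of_forall fun y => by positivity) ?_
  exact Ioc_subset_Ioi_self.eventuallyLE

/-- Multiplying f'' ≥ k f² by f' > 0 gives a first-order inequality. In the rescaled variable z = (f
- f 0)/(Cμ) it reads z' ≥ √(z³ + 1)/μ, so t/μ is at most the integral of 1/√(y³ + 1) from 0 to z. -/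
theorem time_le_of_second_order_inequality {f g h : ℝ → ℝ} {T k C : ℝ} (hk : 0 < k)
    (hC : 0 < C) (hfc : ContinuousOn f (Ico 0 T)) (hgc : ContinuousOn g (Ico 0 T))
    (hf : ∀ t ∈ Ioo 0 T, HasDerivAt f (g t) t) (hg : ∀ t ∈ Ioo 0 T, HasDerivAt g (h t) t)
    (hh : ∀ t ∈ Ioo 0 T, k * f t ^ 2 ≤ h t) (hf0 : 0 ≤ f 0) (hg0 : g 0 = C) :
    T ≤ (2 * k * C / 3) ^ (-(1 / 3) : ℝ) * ∫ y in Ioi (0 : ℝ), 1 / Real.sqrt (y ^ 3 + 1) := by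
  set μ : ℝ := (2 * k * C / 3) ^ (-(1 / 3) : ℝ) with hμ
  set W : ℝ := ∫ y in Ioi (0 : ℝ), 1 / Real.sqrt (y ^ 3 + 1) with hW
  have hq : 0 < 2 * k * C / 3 := by positivity
  have hμ0 : 0 < μ := Real.rpow_pos_of_pos hq _
  have hμ3 : μ ^ 3 = (2 * k * C / 3)⁻¹ := by
    rw [hμ, ← Real.rpow_natCast, ← Real.rpow_mul hq.le, ← Real.rpow_neg_one]
    norm_num
  have hW0 : 0 ≤ W := setIntegral_nonneg measurableSet_Ioi fun y hy => by positivity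
  rcases le_or_gt T 0 with hT | hT
  · exact hT.trans (by positivity)
  have h0 : (0 : ℝ) ∈ Ico 0 T := ⟨le_rfl, hT⟩
  have hint : interior (Ico 0 T) = Ioo 0 T := interior_Ico
  have mono : ∀ {F F' : ℝ → ℝ}, ContinuousOn F (Ico 0 T) →
      (∀ t ∈ Ioo 0 T, HasDerivAt F (F' t) t) → (∀ t ∈ Ioo 0 T, 0 ≤ F' t) →
      MonotoneOn F (Ico 0 T) := by
    intro F F' h1 h2 h3
    refine monotoneOn_of_hasDerivWithinAt_nonneg (convex_Ico _ _) h1 (f' := F') ?_ ?_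
    · rw [hint]; exact fun t ht => (h2 t ht).hasDerivWithinAt
    · rw [hint]; exact h3
  have hgm : MonotoneOn g (Ico 0 T) :=
    mono hgc hg fun t ht => (mul_nonneg hk.le (sq_nonneg _)).trans (hh t ht)
  have hgC : ∀ t ∈ Ico 0 T, C ≤ g t := fun t ht => hg0 ▸ hgm h0 ht ht.1
  have hfm : MonotoneOn f (Ico 0 T) :=
    mono hfc hf fun t ht => hC.le.trans (hgC t (Ioo_subset_Ico_self ht))
  have hff : ∀ t ∈ Ico 0 T, f 0 ≤ f t := fun t ht => hfm h0 ht ht.1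
  have hEm : MonotoneOn (fun t => g t ^ 2 - 2 * k / 3 * f t ^ 3) (Ico 0 T) := by
    refine mono (F' := fun t => 2 * g t * h t - 2 * k / 3 * (3 * f t ^ 2 * g t))
      ((hgc.pow 2).sub (continuousOn_const.mul (hfc.pow 3))) (fun t ht => ?_) (fun t ht => ?_)
    · have h1 := ((hg t ht).pow 2).sub (((hf t ht).pow 3).const_mul (2 * k / 3))
      refine HasDerivAt.congr_deriv (f := fun t => g t ^ 2 - 2 * k / 3 * f t ^ 3) h1 ?_
      norm_num
    · have h1 := hgC t (Ioo_subset_Ico_self ht)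
      have h2 := mul_le_mul_of_nonneg_left (hh t ht) (hC.le.trans h1)
      change 0 ≤ 2 * g t * h t - 2 * k / 3 * (3 * f t ^ 2 * g t)
      nlinarith
  have hkey : ∀ t ∈ Ico 0 T, C * √(|(f t - f 0) / (C * μ)| ^ 3 + 1) ≤ g t := by
    intro t ht
    have h1 := hEm h0 ht ht.1
    simp only [hg0] at h1
    have h2 := hff t ht
    -- Superadditivity of the cube on nonnegative numbers reduces a nonnegative initial value to the
    -- case f 0 = 0.
    have h3 : (f t - f 0) ^ 3 ≤ f t ^ 3 - f 0 ^ 3 := by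
      nlinarith [mul_nonneg (mul_nonneg hf0 (hf0.trans h2)) (sub_nonneg.2 h2)]
    have h4 : C ^ 2 + 2 * k / 3 * (f t - f 0) ^ 3 ≤ g t ^ 2 := by
      have := mul_le_mul_of_nonneg_left h3 (by positivity : 0 ≤ 2 * k / 3)
      linarith
    rw [abs_of_nonneg (div_nonneg (sub_nonneg.2 h2) (by positivity))]
    refine le_of_sq_le_sq ?_ (hC.le.trans (hgC t ht))
    have h5 : 0 ≤ (f t - f 0) / (C * μ) := div_nonneg (sub_nonneg.2 h2) (by positivity)
    rw [mul_pow, Real.sq_sqrt (by positivity), div_pow, mul_pow, hμ3]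
    refine le_trans (le_of_eq ?_) h4
    field_simp
    ring
  set G : ℝ → ℝ := fun z => ∫ y in (0 : ℝ)..z, 1 / Real.sqrt (|y| ^ 3 + 1) with hG
  have hGd : ∀ z, HasDerivAt G (1 / Real.sqrt (|z| ^ 3 + 1)) z := fun z =>
    intervalIntegral.integral_hasDerivAt_right
      (continuous_inv_sqrt_abs_cube.intervalIntegrable _ _)
      (continuous_inv_sqrt_abs_cube.stronglyMeasurableAtFilter _ _)
      continuous_inv_sqrt_abs_cube.continuousAt
  have hGc : Continuous G := continuous_iff_continuousAt.2 fun z => (hGd z).continuousAt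
  have hGm : MonotoneOn (fun t => G ((f t - f 0) / (C * μ)) - t / μ) (Ico 0 T) := by
    refine mono (F' := fun t => 1 / Real.sqrt (|(f t - f 0) / (C * μ)| ^ 3 + 1) * (g t / (C * μ))
      - 1 / μ) ?_ (fun t ht => ?_) (fun t ht => ?_)
    · exact (hGc.comp_continuousOn ((hfc.sub continuousOn_const).div_const _)).sub
        (continuousOn_id.div_const _)
    · have h1 : HasDerivAt (fun t => (f t - f 0) / (C * μ)) (g t / (C * μ)) t :=
        ((hf t ht).sub_const _).div_const _
      exact ((hGd _).comp t h1).sub ((hasDerivAt_id t).div_const μ)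
    · have h1 := hkey t (Ioo_subset_Ico_self ht)
      have h2 : 0 < √(|(f t - f 0) / (C * μ)| ^ 3 + 1) := Real.sqrt_pos.2 (by positivity)
      change 0 ≤ 1 / Real.sqrt (|(f t - f 0) / (C * μ)| ^ 3 + 1) * (g t / (C * μ)) - 1 / μ
      rw [sub_nonneg, div_mul_div_comm, one_mul, div_le_div_iff₀ hμ0 (by positivity)]
      nlinarith
  have hfin : ∀ t ∈ Ico 0 T, t ≤ μ * W := by
    intro t ht
    have h1 := hGm h0 ht ht.1
    have h2 : G 0 = 0 := intervalIntegral.integral_same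
    simp only [sub_self, zero_div, h2] at h1
    have h3 : G ((f t - f 0) / (C * μ)) ≤ W :=
      integral_inv_sqrt_abs_cube_le (div_nonneg (sub_nonneg.2 (hff t ht)) (by positivity))
    have h4 : t / μ ≤ W := by linarith
    rwa [div_le_iff₀ hμ0, mul_comm] at h4
  refine le_of_forall_lt_imp_le_of_dense fun t ht => ?_
  rcases le_or_gt 0 t with h1 | h1
  · exact hfin t ⟨h1, ht⟩
  · exact h1.le.trans (by positivity)

/-! ### A lower bound for the quadratic form of the Hilbert transform -/

section Autocorrelation

variable {f : ℝ → ℝ}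

/-- The autocorrelation of a function on the line. -/
noncomputable def autocorr (f : ℝ → ℝ) (s : ℝ) : ℝ := ∫ x, f x * f (x - s)

theorem autocorr_eq_convolution (f : ℝ → ℝ) :
    autocorr f = convolution f (fun y => f (-y)) (ContinuousLinearMap.mul ℝ ℝ) volume := by
  funext s
  simp only [autocorr, convolution, ContinuousLinearMap.mul_apply', neg_sub]

theorem integrable_autocorr (hf : Integrable f) : Integrable (autocorr f) := by
  rw [autocorr_eq_convolution]
  exact hf.integrable_convolution _ hf.comp_neg

theorem integral_autocorr (hf : Integrable f) : ∫ s, autocorr f s = (∫ x, f x) ^ 2 := by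
  rw [autocorr_eq_convolution, integral_convolution _ hf hf.comp_neg,
    ContinuousLinearMap.mul_apply', integral_neg_eq_self, sq]

theorem autocorr_neg (f : ℝ → ℝ) (s : ℝ) : autocorr f (-s) = autocorr f s := by
  have h := integral_sub_right_eq_self (μ := volume) (fun x => f x * f (x - -s)) s
  rw [autocorr, ← h, autocorr]
  refine integral_congr_ae (Eventually.of_forall fun x => ?_)
  simp only [sub_neg_eq_add, sub_add_cancel]
  ring

/-- The autocorrelation is even, and by Fubini its total integral is (∫f)². -/
theorem integral_Ioi_autocorr (hf : Integrable f) :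
    ∫ s in Ioi (0 : ℝ), autocorr f s = (∫ x, f x) ^ 2 / 2 := by
  have h := integral_comp_abs (f := autocorr f)
  have h2 : ∫ s, autocorr f |s| = ∫ s, autocorr f s := by
    refine integral_congr_ae (Eventually.of_forall fun s => ?_)
    change autocorr f |s| = autocorr f s
    rcases abs_choice s with h | h <;> rw [h]
    exact autocorr_neg f s
  rw [h2, integral_autocorr hf] at h
  linarith

theorem autocorr_eq_zero {a b : ℝ} (hf : ∀ x, x ∉ Ioo a b → f x = 0) {s : ℝ} (hs : b - a ≤ s) :
    autocorr f s = 0 := by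
  rw [autocorr]
  refine integral_eq_zero_of_ae (Eventually.of_forall fun x => ?_)
  by_cases hx : x ∈ Ioo a b
  · have : f (x - s) = 0 := hf _ fun h => by linarith [h.1, hx.2]
    simp [this]
  · simp [hf x hx]

/-- Translating the second term by s turns its weight into x - s - a; subtracting from x - a leaves
exactly the factor s. -/
theorem integral_moment_mul_sub {a b M : ℝ} (hf : Measurable f) (hM : ∀ x, |f x| ≤ M)
    (hs : ∀ x, x ∉ Ioo a b → f x = 0) (hfi : Integrable f) (s : ℝ) :
    ∫ x, (x - a) * f x * (f (x - s) - f (x + s)) = s * autocorr f s := by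
  have hmom : Integrable fun x => (x - a) * f x := by
    refine Integrable.mono' (hfi.norm.const_mul (b - a)) (by fun_prop)
      (Eventually.of_forall fun x => ?_)
    rw [norm_mul]
    by_cases hx : x ∈ Ioo a b
    · refine mul_le_mul_of_nonneg_right ?_ (norm_nonneg _)
      rw [Real.norm_eq_abs, abs_of_pos (by linarith [hx.1])]
      linarith [hx.2]
    · simp [hs x hx]
  have hb : ∀ {g h : ℝ → ℝ}, Integrable g → Measurable h → (∀ x, |h x| ≤ M) →
      Integrable fun x => g x * h x := fun hg hh hb =>
    hg.mul_bdd (c := M) hh.aestronglyMeasurable (Eventually.of_forall hb)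
  have h1 : Integrable fun x => (x - a) * f x * f (x - s) :=
    hb hmom (by fun_prop) fun x => hM _
  have h2 : Integrable fun x => (x - a) * f x * f (x + s) :=
    hb hmom (by fun_prop) fun x => hM _
  have h3 := integral_sub_right_eq_self (μ := volume) (fun x => (x - a) * f x * f (x + s)) s
  have h4 : Integrable fun x => (x - s - a) * f (x - s) * f (x - s + s) := h2.comp_sub_right s
  simp only [mul_sub]
  rw [integral_sub h1 h2, ← h3, ← integral_sub h1 h4, autocorr, ← integral_const_mul]
  refine integral_congr_ae (Eventually.of_forall fun x => ?_)
  simp only [sub_add_cancel]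
  ring

end Autocorrelation

/-- From sin(s/2) ≤ s/2 one gets s cot(s/2) ≥ 2 cos(s/2), and the cosine decreases on [0, π]. -/
theorem two_mul_cos_le_mul_cot {s L : ℝ} (hs : 0 < s) (hsL : s ≤ L) (hL : L < Real.pi) :
    2 * Real.cos (L / 2) ≤ s * Real.cot (s / 2) := by
  have hsin : 0 < Real.sin (s / 2) :=
    Real.sin_pos_of_pos_of_lt_pi (by linarith) (by linarith)
  have h1 : Real.sin (s / 2) ≤ s / 2 := Real.sin_le (by linarith)
  have h2 : Real.cos (L / 2) ≤ Real.cos (s / 2) :=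
    Real.cos_le_cos_of_nonneg_of_le_pi (by linarith) (by linarith) (by linarith)
  have h3 : 0 ≤ Real.cos (s / 2) :=
    Real.cos_nonneg_of_mem_Icc ⟨by linarith, by linarith⟩
  rw [real_cot_eq, ← mul_div_assoc, le_div_iff₀ hsin]
  nlinarith

theorem H1.integral_moment_hilbertEval_ge (F : H1) {a b : ℝ} (hab : a < b) (ha : 0 ≤ a)
    (hb : b ≤ 2 * Real.pi) (hlen : b - a < Real.pi) (hpos : ∀ x, 0 ≤ F.rep x)
    (hF : ∀ x ∈ Icc 0 (2 * Real.pi), x ∉ Ioo a b → F.rep x = 0) :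
    Real.cos ((b - a) / 2) / (2 * Real.pi) * (∫ x in a..b, F.rep x) ^ 2
      ≤ ∫ x in a..b, (x - a) * F.rep x * hilbertEval x F := by
  have hpi := Real.pi_pos
  set f : ℝ → ℝ := (Ioo a b).indicator F.rep with hf
  have hfm : Measurable f := F.continuous_rep.measurable.indicator measurableSet_Ioo
  have hf0 : ∀ x, x ∉ Ioo a b → f x = 0 := fun x hx => indicator_of_notMem hx _
  have hf1 : ∀ x ∈ Ioo a b, f x = F.rep x := fun x hx => indicator_of_mem hx _
  have hfpos : ∀ x, 0 ≤ f x := fun x => indicator_nonneg (fun x _ => hpos x) x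
  have hfi : Integrable f := by
    rw [hf, integrable_indicator_iff measurableSet_Ioo]
    exact (F.continuous_rep.integrableOn_Icc).mono_set Ioo_subset_Icc_self
  obtain ⟨M, hM⟩ : ∃ M, ∀ x, |f x| ≤ M := by
    obtain ⟨M, hM⟩ := isCompact_Icc.exists_bound_of_continuousOn (s := Icc a b)
      F.continuous_rep.continuousOn
    refine ⟨max M 0, fun x => ?_⟩
    by_cases hx : x ∈ Ioo a b
    · rw [hf1 x hx]
      exact (hM x (Ioo_subset_Icc_self hx)).trans (le_max_left _ _)
    · rw [hf0 x hx, abs_zero]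
      exact le_max_right _ _
  -- Because b - a < π, a shift by at most π from (a, b) cannot reach another periodic copy of the
  -- support. The periodic function may thus be replaced by its cutoff to one copy.
  have hshift : ∀ x ∈ Ioo a b, ∀ s, |s| ≤ Real.pi → F.rep (x + s) = f (x + s) := by
    intro x hx s hs
    obtain ⟨h1, h2⟩ := abs_le.1 hs
    by_cases hm : x + s ∈ Ioo a b
    · rw [hf1 _ hm]
    · rw [hf0 _ hm]
      rcases lt_or_ge (x + s) 0 with h3 | h3
      · rw [← F.rep_periodic]
        exact hF _ ⟨by linarith [hx.1], by linarith⟩ fun h => by linarith [h.2, hx.1]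
      · rcases le_or_gt (x + s) (2 * Real.pi) with h4 | h4
        · exact hF _ ⟨h3, h4⟩ hm
        · rw [← F.rep_periodic.sub_eq]
          exact hF _ ⟨by linarith, by linarith [hx.2]⟩ fun h => by linarith [h.1, hx.2]
  have hint : ∀ x ∈ Ioo a b, ∀ s ∈ Ioc 0 Real.pi,
      hilbertIntegrand F.rep x s = (f (x - s) - f (x + s)) * Real.cot (s / 2) := by
    intro x hx s hs
    have h1 := hshift x hx s (by rw [abs_of_pos hs.1]; exact hs.2)
    have h2 := hshift x hx (-s) (by rw [abs_neg, abs_of_pos hs.1]; exact hs.2)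
    rw [← sub_eq_add_neg] at h2
    rw [hilbertIntegrand, h1, h2]
  set h : ℝ → ℝ → ℝ := fun x s =>
    (x - a) * f x * ((f (x - s) - f (x + s)) * Real.cot (s / 2)) with hh
  -- Fubini is justified by the majorant (b - a)|f(x)| times a multiple of s^(-1/2).
  have hprod : Integrable (Function.uncurry h)
      (volume.prod (volume.restrict (Ioc 0 Real.pi))) := by
    have i1 : Integrable fun x => (b - a) * |f x| := hfi.abs.const_mul _
    have i2 : Integrable (fun s : ℝ => 2 * √2 * ‖F‖ * s ^ (-(1 / 2) : ℝ))
        (volume.restrict (Ioc 0 Real.pi)) := by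
      refine Integrable.const_mul ?_ _
      have := intervalIntegrable_rpow_neg_half 0 Real.pi
      rwa [intervalIntegrable_iff_integrableOn_Ioc_of_le hpi.le] at this
    refine (i1.mul_prod i2).mono' ?_ ?_
    · refine Measurable.aestronglyMeasurable ?_
      have hc : Measurable fun p : ℝ × ℝ => Real.cot (p.2 / 2) :=
        measurable_cot_half.comp measurable_snd
      simp only [hh, Function.uncurry_def]
      fun_prop
    · have hae : ∀ᵐ p : ℝ × ℝ ∂(volume.prod (volume.restrict (Ioc 0 Real.pi))),
          p.2 ∈ Ioc 0 Real.pi :=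
        Measure.quasiMeasurePreserving_snd.ae (ae_restrict_mem measurableSet_Ioc)
      filter_upwards [hae] with p hp
      change |(p.1 - a) * f p.1 * ((f (p.1 - p.2) - f (p.1 + p.2)) * Real.cot (p.2 / 2))|
        ≤ (b - a) * |f p.1| * (2 * √2 * ‖F‖ * p.2 ^ (-(1 / 2) : ℝ))
      by_cases hx : p.1 ∈ Ioo a b
      · rw [← hint _ hx _ hp, abs_mul, abs_mul]
        refine mul_le_mul ?_ (F.abs_hilbertIntegrand_le _ hp) (abs_nonneg _)
          (mul_nonneg (by linarith) (abs_nonneg _))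
        refine mul_le_mul_of_nonneg_right ?_ (abs_nonneg _)
        rw [abs_of_pos (by linarith [hx.1])]
        linarith [hx.2]
      · simp [hf0 _ hx]
  have hleft : ∫ x in a..b, (x - a) * F.rep x * hilbertEval x F
      = 1 / (2 * Real.pi) * ∫ x, ∫ s in Ioc 0 Real.pi, h x s := by
    rw [intervalIntegral.integral_of_le hab.le, integral_Ioc_eq_integral_Ioo,
      ← integral_indicator measurableSet_Ioo, ← integral_const_mul]
    refine integral_congr_ae (Eventually.of_forall fun x => ?_)
    simp only [hh]
    rw [integral_const_mul]
    by_cases hx : x ∈ Ioo a b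
    · rw [indicator_of_mem hx, hilbertEval_apply, hf1 x hx,
        intervalIntegral.integral_of_le hpi.le,
        setIntegral_congr_fun measurableSet_Ioc (fun s hs => hint x hx s hs)]
      ring
    · rw [indicator_of_notMem hx, hf0 x hx]
      ring
  have hinner : ∀ s, ∫ x, h x s = s * Real.cot (s / 2) * autocorr f s := by
    intro s
    have := integral_moment_mul_sub hfm hM hf0 hfi s
    simp only [hh, ← mul_assoc]
    rw [integral_mul_const, this]
    ring
  have hswap : ∫ x, ∫ s in Ioc 0 Real.pi, h x s
      = ∫ s in Ioc 0 Real.pi, s * Real.cot (s / 2) * autocorr f s := by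
    rw [integral_integral_swap hprod]
    simp only [hinner]
  have hri : IntegrableOn (fun s => s * Real.cot (s / 2) * autocorr f s) (Ioc 0 Real.pi) := by
    have := hprod.integral_prod_right
    simp only [Function.uncurry_apply_pair, hinner] at this
    exact this
  have hlow : 2 * Real.cos ((b - a) / 2) * ∫ s in Ioc 0 Real.pi, autocorr f s
      ≤ ∫ s in Ioc 0 Real.pi, s * Real.cot (s / 2) * autocorr f s := by
    rw [← integral_const_mul]
    refine setIntegral_mono_on ((integrable_autocorr hfi).integrableOn.const_mul _) hri
      measurableSet_Ioc fun s hs => ?_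
    rcases le_total s (b - a) with h1 | h1
    · refine mul_le_mul_of_nonneg_right (two_mul_cos_le_mul_cot hs.1 h1 hlen) ?_
      exact integral_nonneg fun x => mul_nonneg (hfpos _) (hfpos _)
    · rw [autocorr_eq_zero hf0 h1, mul_zero, mul_zero]
  have hIoc : ∫ s in Ioc 0 Real.pi, autocorr f s = (∫ x, f x) ^ 2 / 2 := by
    rw [← integral_Ioi_autocorr hfi]
    refine (setIntegral_eq_of_subset_of_forall_sdiff_eq_zero measurableSet_Ioi
      Ioc_subset_Ioi_self fun s hs => ?_).symm
    refine autocorr_eq_zero hf0 (hlen.le.trans ?_)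
    by_contra hlt
    exact hs.2 ⟨hs.1, (not_le.1 hlt).le⟩
  have hfint : ∫ x, f x = ∫ x in a..b, F.rep x := by
    rw [hf, integral_indicator measurableSet_Ioo, intervalIntegral.integral_of_le hab.le,
      integral_Ioc_eq_integral_Ioo]
  rw [hIoc, hfint] at hlow
  rw [hleft, hswap]
  have h5 := mul_le_mul_of_nonneg_left hlow (by positivity : 0 ≤ 1 / (2 * Real.pi))
  refine le_trans (le_of_eq ?_) h5
  field_simp

/-! ### The system as a differential equation in `H¹ × H¹` -/

theorem H1.continuous_mul : Continuous fun p : H1 × H1 => p.1.mul p.2 :=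
  isBoundedBilinearMap_mul.continuous

theorem HasDerivAt.h1_mul {u v : ℝ → H1} {u' v' : H1} {t : ℝ} (hu : HasDerivAt u u' t)
    (hv : HasDerivAt v v' t) :
    HasDerivAt (fun s => (u s).mul (v s)) ((u t).mul v' + u'.mul (v t)) t := by
  have h := HasFDerivAt.comp_hasDerivAt (f := fun s => (u s, v s))
    (l := fun p : H1 × H1 => p.1.mul p.2) t (isBoundedBilinearMap_mul.hasFDerivAt (u t, v t))
    (hu.prodMk hv)
  refine HasDerivAt.congr_deriv h ?_
  rw [IsBoundedBilinearMap.deriv_apply]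

/-- The vector field of the system `u_t = 2uv`, `v_t = H(u²)`. -/
noncomputable def systemField (p : H1 × H1) : H1 × H1 :=
  ((2 : ℝ) • p.1.mul p.2, hilbertL (p.1.mul p.1))

theorem continuous_systemField : Continuous systemField := by
  refine Continuous.prodMk ?_ ?_
  · exact H1.continuous_mul.const_smul (2 : ℝ)
  · exact hilbertL.continuous.comp (H1.continuous_mul.comp (continuous_fst.prodMk continuous_fst))

theorem exists_norm_mul_le : ∃ M : ℝ, 0 ≤ M ∧ ∀ f g : H1, ‖f.mul g‖ ≤ M * ‖f‖ * ‖g‖ :=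
  ⟨3 * (‖baseL‖ + √(2 * Real.pi)), by positivity, norm_mul_le_repL⟩

theorem H1.mul_sub_mul (f g f' g' : H1) :
    f.mul g - f'.mul g' = (f - f').mul g + f'.mul (g - g') := by
  refine H1.ext_rep fun x => ?_
  simp only [H1.rep_add, H1.rep_sub, H1.rep_mul]
  ring

theorem exists_norm_mul_sub_mul_le (R : ℝ) (hR : 0 ≤ R) : ∃ K : ℝ, 0 ≤ K ∧
    ∀ p q : H1 × H1, ‖p‖ ≤ R → ‖q‖ ≤ R → ‖p.1.mul p.2 - q.1.mul q.2‖ ≤ K * ‖p - q‖ := by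
  obtain ⟨M, hM0, hM⟩ := exists_norm_mul_le
  refine ⟨M * R + M * R, by positivity, fun p q hp hq => ?_⟩
  rw [H1.mul_sub_mul, add_mul]
  refine (norm_add_le _ _).trans (add_le_add ?_ ?_)
  · refine (hM _ _).trans ?_
    rw [mul_assoc, mul_assoc, mul_comm R]
    exact mul_le_mul_of_nonneg_left (mul_le_mul (norm_fst_le (p - q)) ((norm_snd_le p).trans hp)
      (norm_nonneg _) (norm_nonneg _)) hM0
  · refine (hM _ _).trans ?_
    rw [mul_assoc, mul_assoc]
    exact mul_le_mul_of_nonneg_left (mul_le_mul ((norm_fst_le q).trans hq) (norm_snd_le (p - q))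
      (norm_nonneg _) hR) hM0

theorem lipschitzOnWith_systemField (R : ℝ) :
    ∃ K, LipschitzOnWith K systemField (Metric.closedBall 0 R) := by
  obtain ⟨K, hK0, hK⟩ := exists_norm_mul_sub_mul_le (max R 0) (le_max_right _ _)
  refine ⟨⟨max (2 * K) (‖hilbertL‖ * K), by positivity⟩,
    LipschitzOnWith.of_dist_le_mul fun p hp q hq => ?_⟩
  rw [mem_closedBall_zero_iff] at hp hq
  have hp' := hp.trans (le_max_left R 0)
  have hq' := hq.trans (le_max_left R 0)
  rw [dist_eq_norm, dist_eq_norm]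
  change max ‖(2 : ℝ) • p.1.mul p.2 - (2 : ℝ) • q.1.mul q.2‖
    ‖hilbertL (p.1.mul p.1) - hilbertL (q.1.mul q.1)‖ ≤ max (2 * K) (‖hilbertL‖ * K) * ‖p - q‖
  refine max_le ?_ ?_
  · rw [← smul_sub, norm_smul, Real.norm_ofNat]
    have h1 := hK p q hp' hq'
    have h2 := mul_le_mul_of_nonneg_right (le_max_left (2 * K) (‖hilbertL‖ * K))
      (norm_nonneg (p - q))
    linarith
  · rw [← map_sub]
    have hd : ∀ r : H1 × H1, ‖(r.1, r.1)‖ ≤ ‖r‖ := fun r =>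
      max_le (norm_fst_le r) (norm_fst_le r)
    have h1 := hK (p.1, p.1) (q.1, q.1) ((hd p).trans hp') ((hd q).trans hq')
    have h3 : ‖(p.1, p.1) - (q.1, q.1)‖ ≤ ‖p - q‖ := hd (p - q)
    have h4 := mul_le_mul_of_nonneg_left (h1.trans (mul_le_mul_of_nonneg_left h3 hK0))
      (norm_nonneg hilbertL)
    have h2 := mul_le_mul_of_nonneg_right (le_max_right (2 * K) (‖hilbertL‖ * K))
      (norm_nonneg (p - q))
    have h5 := hilbertL.le_opNorm (p.1.mul p.1 - q.1.mul q.1)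
    refine h5.trans (h4.trans ?_)
    rw [← mul_assoc]
    exact h2

theorem fn_two_smul_mul_ae (u v : H1) :
    ((2 : ℝ) • u.mul v).fn =ᵐ[volume] fun x => 2 * u.fn x * v.fn x := by
  filter_upwards [((2 : ℝ) • u.mul v).fn_ae_rep, u.fn_ae_rep, v.fn_ae_rep] with x h1 h2 h3
  rw [h1, h2, h3, H1.rep_smul, H1.rep_mul, mul_assoc]

/-- An element of H¹ is determined by its values almost everywhere, so the pointwise equations fix
the time derivatives in H¹. -/
theorem IsSolution.isFlowLine {u₀ v₀ : H1} {T : ℝ} {u v : ℝ → H1}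
    (h : IsSolution u₀ v₀ T u v) :
    IsFlowLine systemField (u₀, v₀) T fun t => (u t, v t) := by
  refine ⟨by rw [h.init_u, h.init_v], fun t ht => ?_⟩
  have hu := ((h.contDiffOn_u.differentiableOn (by simp)) t ht).hasDerivWithinAt
  have hv := ((h.contDiffOn_v.differentiableOn (by simp)) t ht).hasDerivWithinAt
  have e1 : derivWithin u (Ico 0 T) t = (2 : ℝ) • (u t).mul (v t) :=
    H1.ext_fn (EventuallyEq.trans (h.eq_u t ht) (fn_two_smul_mul_ae _ _).symm)
  have e2 : derivWithin v (Ico 0 T) t = hilbertL ((u t).mul (u t)) :=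
    eq_hilbertL_of_isHilbertTransform (u t).sq_fn_ae (h.eq_v t ht)
  rw [e1] at hu
  rw [e2] at hv
  exact hu.prodMk hv

theorem IsFlowLine.isSolution {u₀ v₀ : H1} {T : ℝ} {γ : ℝ → H1 × H1}
    (h : IsFlowLine systemField (u₀, v₀) T γ) :
    IsSolution u₀ v₀ T (fun t => (γ t).1) fun t => (γ t).2 := by
  have hU : UniqueDiffOn ℝ (Ico (0 : ℝ) T) := uniqueDiffOn_Ico 0 T
  have hu : ∀ t ∈ Ico 0 T, HasDerivWithinAt (fun t => (γ t).1) (systemField (γ t)).1 (Ico 0 T) t :=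
    fun t ht => (h.deriv t ht).fst
  have hv : ∀ t ∈ Ico 0 T, HasDerivWithinAt (fun t => (γ t).2) (systemField (γ t)).2 (Ico 0 T) t :=
    fun t ht => (h.deriv t ht).snd
  have hc : ContinuousOn (fun t => systemField (γ t)) (Ico 0 T) :=
    continuous_systemField.comp_continuousOn h.continuousOn
  refine ⟨?_, ?_, by rw [h.init], by rw [h.init], fun t ht => ?_, fun t ht => ?_⟩
  · rw [contDiffOn_one_iff_derivWithin hU]
    refine ⟨fun t ht => (hu t ht).differentiableWithinAt, ?_⟩
    exact (continuous_fst.comp_continuousOn hc).congr fun t ht => (hu t ht).derivWithin (hU t ht)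
  · rw [contDiffOn_one_iff_derivWithin hU]
    refine ⟨fun t ht => (hv t ht).differentiableWithinAt, ?_⟩
    exact (continuous_snd.comp_continuousOn hc).congr fun t ht => (hv t ht).derivWithin (hU t ht)
  · rw [(hu t ht).derivWithin (hU t ht)]
    exact fn_two_smul_mul_ae _ _
  · rw [(hv t ht).derivWithin (hU t ht)]
    exact isHilbertTransform_hilbertL (γ t).1.sq_fn_ae

/-! ### Bound for the lifespan -/

theorem H1.continuous_moment (a : ℝ) (f : H1) : Continuous fun x => (x - a) * f.rep x :=
  Continuous.mul (f := fun x => x - a) (by fun_prop) f.continuous_rep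

/-- The first moment `∫ (x - a) f(x) dx` over `[a,b]`. -/
noncomputable def momentL (a b : ℝ) (hab : a ≤ b) : H1 →L[ℝ] ℝ :=
  LinearMap.mkContinuous
    { toFun := fun f => ∫ x in a..b, (x - a) * f.rep x
      map_add' := fun f g => by
        rw [← intervalIntegral.integral_add
          ((f.continuous_moment a).intervalIntegrable _ _)
          ((g.continuous_moment a).intervalIntegrable _ _)]
        refine intervalIntegral.integral_congr fun x _ => ?_
        simp only [H1.rep_add]
        ring
      map_smul' := fun c f => by
        rw [RingHom.id_apply, smul_eq_mul, ← intervalIntegral.integral_const_mul]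
        refine intervalIntegral.integral_congr fun x _ => ?_
        simp only [H1.rep_smul]
        ring }
    ((b - a) * (‖baseL‖ + √(2 * Real.pi)) * (b - a)) (fun f => by
      have h := intervalIntegral.norm_integral_le_of_norm_le_const (a := a) (b := b)
        (f := fun x => (x - a) * f.rep x) (C := (b - a) * ((‖baseL‖ + √(2 * Real.pi)) * ‖f‖))
        (fun x hx => by
          rw [uIoc_of_le hab] at hx
          rw [norm_mul]
          refine mul_le_mul ?_ (((repL f).norm_coe_le_norm _).trans (norm_repL_le f))
            (norm_nonneg _) (by linarith)
          rw [Real.norm_eq_abs, abs_of_pos (by linarith [hx.1])]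
          linarith [hx.2])
      rw [abs_of_nonneg (by linarith)] at h
      refine h.trans (le_of_eq ?_)
      ring)

theorem momentL_apply (a b : ℝ) (hab : a ≤ b) (f : H1) :
    momentL a b hab f = ∫ x in a..b, (x - a) * f.rep x := rfl

/-- Modulo the period, the complement of (a, b) is the nondegenerate interval [b, a + 2π]. A
continuous function vanishing almost everywhere there vanishes on all of it, endpoints included,
even when a = 0 or b = 2π. -/
theorem H1.rep_eq_zero_of_ae {u₀ : H1} {a b : ℝ} (hab : a < b) (ha : 0 ≤ a)
    (hb : b ≤ 2 * Real.pi) (hlen : b - a < Real.pi)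
    (hsupp : ∀ᵐ x : ℝ, x ∈ Ioo 0 (2 * Real.pi) → x ∉ Ioo a b → u₀.fn x = 0) :
    ∀ x ∈ Icc 0 (2 * Real.pi), x ∉ Ioo a b → u₀.rep x = 0 := by
  have hpi := Real.pi_pos
  have h1 : ∀ᵐ x : ℝ, x ∈ Ioo 0 (2 * Real.pi) → x ∉ Ioo a b → u₀.rep x = 0 := by
    filter_upwards [hsupp, u₀.fn_ae_rep] with x h1 h2 h3 h4
    rw [← h2, h1 h3 h4]
  have h2 : ∀ᵐ x : ℝ, x - 2 * Real.pi ∈ Ioo 0 (2 * Real.pi) → x - 2 * Real.pi ∉ Ioo a b →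
      u₀.rep (x - 2 * Real.pi) = 0 :=
    (measurePreserving_sub_right volume (2 * Real.pi)).quasiMeasurePreserving.ae h1
  have h3 : ∀ᵐ x : ℝ, x ≠ 2 * Real.pi := by simp [ae_iff]
  have h4 : EqOn u₀.rep (fun _ => 0) (Icc b (a + 2 * Real.pi)) := by
    refine Measure.eqOn_Icc_of_ae_eq volume (by linarith) ?_ u₀.continuous_rep.continuousOn
      continuousOn_const
    refine (ae_restrict_iff' measurableSet_Icc).2 ?_
    filter_upwards [h1, h2, h3] with x hx1 hx2 hx3 hx
    rcases lt_or_gt_of_ne hx3 with h | h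
    · exact hx1 ⟨by linarith [hx.1], h⟩ fun h' => by linarith [h'.2, hx.1]
    · rw [← u₀.rep_periodic.sub_eq]
      exact hx2 ⟨by linarith, by linarith [hx.2]⟩ fun h' => by linarith [h'.1, hx.2]
  intro x hx hxab
  rcases le_or_gt b x with h | h
  · exact h4 ⟨h, by linarith [hx.2]⟩
  · have hxa : x ≤ a := by
      by_contra hlt
      exact hxab ⟨not_le.1 hlt, h⟩
    rw [← u₀.rep_periodic]
    exact h4 ⟨by linarith [hx.1], by linarith⟩

/-- At fixed x the value of u solves a linear scalar ODE whose coefficient 2v is bounded on compact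
time intervals; Grönwall propagates the zero. -/
theorem IsFlowLine.rep_eq_zero {u₀ v₀ : H1} {T : ℝ} {γ : ℝ → H1 × H1}
    (h : IsFlowLine systemField (u₀, v₀) T γ) {x : ℝ} (hx : u₀.rep x = 0) {t : ℝ}
    (ht : t ∈ Ico 0 T) : (γ t).1.rep x = 0 := by
  have hsub : Icc 0 t ⊆ Ico 0 T := fun s hs => ⟨hs.1, hs.2.trans_lt ht.2⟩
  have hc : ContinuousOn γ (Icc 0 t) := h.continuousOn.mono hsub
  obtain ⟨K, hK⟩ := isCompact_Icc.exists_bound_of_continuousOn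
    (((evL x).continuous.comp continuous_snd).comp_continuousOn hc)
  refine eq_zero_of_abs_deriv_le_mul_abs_self_of_eq_zero_right
    (f := fun s => (γ s).1.rep x) (f' := fun s => 2 * ((γ s).1.rep x * (γ s).2.rep x))
    (K := 2 * K) (a := 0) (b := t) ?_ (fun s hs => ?_) ?_ (fun s hs => ?_) t
    (right_mem_Icc.2 ht.1)
  · exact ((evL x).continuous.comp continuous_fst).comp_continuousOn hc
  · have h1 := (h.hasDerivWithinAt_Ici (hsub (Ico_subset_Icc_self hs))).fst
    have h2 := (evL x).hasFDerivAt.comp_hasDerivWithinAt s h1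
    refine HasDerivWithinAt.congr_deriv h2 ?_
    change ((2 : ℝ) • (γ s).1.mul (γ s).2).rep x = _
    rw [H1.rep_smul, H1.rep_mul]
  · change (γ 0).1.rep x = 0
    rw [h.init]
    exact hx
  · have h1 : ‖(γ s).2.rep x‖ ≤ K := hK s (Ico_subset_Icc_self hs)
    rw [norm_mul, norm_mul, Real.norm_ofNat]
    have h2 := mul_le_mul_of_nonneg_left h1 (norm_nonneg ((γ s).1.rep x))
    linarith

theorem momentL_mul_hilbertL_ge (F : H1) {a b : ℝ} (hab : a < b) (ha : 0 ≤ a)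
    (hb : b ≤ 2 * Real.pi) (hlen : b - a < Real.pi) (hpos : ∀ x, 0 ≤ F.rep x)
    (hF : ∀ x ∈ Icc 0 (2 * Real.pi), x ∉ Ioo a b → F.rep x = 0) :
    Real.cos ((b - a) / 2) / (2 * Real.pi * (b - a) ^ 2) * momentL a b hab.le F ^ 2
      ≤ momentL a b hab.le (F.mul (hilbertL F)) := by
  have hpi := Real.pi_pos
  have h1 := F.integral_moment_hilbertEval_ge hab ha hb hlen hpos hF
  have hcos : 0 ≤ Real.cos ((b - a) / 2) :=
    Real.cos_nonneg_of_mem_Icc ⟨by linarith, by linarith⟩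
  have h2 : momentL a b hab.le (F.mul (hilbertL F))
      = ∫ x in a..b, (x - a) * F.rep x * hilbertEval x F := by
    rw [momentL_apply]
    refine intervalIntegral.integral_congr fun x _ => ?_
    simp only [H1.rep_mul, rep_hilbertL, mul_assoc]
  have hi : IntervalIntegrable (fun x => (x - a) * F.rep x) volume a b :=
    (F.continuous_moment a).intervalIntegrable _ _
  -- Bounding the weight by b - a trades the mass for the moment, which closes the inequality in a
  -- single quantity.
  have h3 : momentL a b hab.le F ≤ (b - a) * ∫ x in a..b, F.rep x := by
    rw [momentL_apply, ← intervalIntegral.integral_const_mul]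
    refine intervalIntegral.integral_mono_on hab.le hi
      ((F.continuous_rep.intervalIntegrable _ _).const_mul _) fun x hx => ?_
    exact mul_le_mul_of_nonneg_right (by linarith [hx.2]) (hpos x)
  have h4 : 0 ≤ momentL a b hab.le F :=
    intervalIntegral.integral_nonneg hab.le fun x hx =>
      mul_nonneg (by linarith [hx.1]) (hpos x)
  have h5 : momentL a b hab.le F ^ 2 ≤ ((b - a) * ∫ x in a..b, F.rep x) ^ 2 :=
    pow_le_pow_left₀ h4 h3 2
  rw [h2]
  refine le_trans ?_ h1
  have hba : 0 < b - a := by linarith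
  have h6 := mul_le_mul_of_nonneg_left h5
    (by positivity : 0 ≤ Real.cos ((b - a) / 2) / (2 * Real.pi * (b - a) ^ 2))
  refine h6.trans (le_of_eq ?_)
  field_simp

/-! ### Evolution of the moment of u² along a solution -/

theorem IsFlowLine.hasDerivAt {p : H1 × H1} {T : ℝ} {γ : ℝ → H1 × H1}
    (h : IsFlowLine systemField p T γ) {t : ℝ} (ht : t ∈ Ioo 0 T) :
    HasDerivAt γ (systemField (γ t)) t :=
  (h.deriv t (Ioo_subset_Ico_self ht)).hasDerivAt (Ico_mem_nhds ht.1 ht.2)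

theorem H1.mul_two_smul_mul (u v : H1) :
    u.mul ((2 : ℝ) • u.mul v) + ((2 : ℝ) • u.mul v).mul u = (4 : ℝ) • (u.mul u).mul v := by
  refine H1.ext_rep fun x => ?_
  simp only [H1.rep_add, H1.rep_mul, H1.rep_smul]
  ring

theorem IsFlowLine.hasDerivAt_sq {p : H1 × H1} {T : ℝ} {γ : ℝ → H1 × H1}
    (h : IsFlowLine systemField p T γ) {t : ℝ} (ht : t ∈ Ioo 0 T) :
    HasDerivAt (fun s => (γ s).1.mul (γ s).1)
      ((4 : ℝ) • ((γ t).1.mul (γ t).1).mul (γ t).2) t := by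
  have hu : HasDerivAt (fun s => (γ s).1) ((2 : ℝ) • (γ t).1.mul (γ t).2) t :=
    (h.hasDerivAt ht).fst
  refine HasDerivAt.congr_deriv (HasDerivAt.h1_mul hu hu) ?_
  exact H1.mul_two_smul_mul _ _

theorem IsFlowLine.hasDerivAt_sq_mul {p : H1 × H1} {T : ℝ} {γ : ℝ → H1 × H1}
    (h : IsFlowLine systemField p T γ) {t : ℝ} (ht : t ∈ Ioo 0 T) :
    HasDerivAt (fun s => ((γ s).1.mul (γ s).1).mul (γ s).2)
      (((γ t).1.mul (γ t).1).mul (hilbertL ((γ t).1.mul (γ t).1))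
        + ((4 : ℝ) • ((γ t).1.mul (γ t).1).mul (γ t).2).mul (γ t).2) t := by
  have hv : HasDerivAt (fun s => (γ s).2) (hilbertL ((γ t).1.mul (γ t).1)) t :=
    (h.hasDerivAt ht).snd
  exact HasDerivAt.h1_mul (h.hasDerivAt_sq ht) hv

theorem momentL_nonneg {a b : ℝ} (hab : a ≤ b) {F : H1} (hF : ∀ x, 0 ≤ F.rep x) :
    0 ≤ momentL a b hab F := by
  rw [momentL_apply]
  exact intervalIntegral.integral_nonneg hab fun x hx =>
    mul_nonneg (by linarith [hx.1]) (hF x)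

theorem H1.rep_mul_self_nonneg (u : H1) (x : ℝ) : 0 ≤ (u.mul u).rep x := by
  rw [H1.rep_mul]
  exact mul_self_nonneg _

theorem H1.rep_sq_mul_sq_nonneg (u v : H1) (x : ℝ) :
    0 ≤ (((4 : ℝ) • (u.mul u).mul v).mul v).rep x := by
  simp only [H1.rep_mul, H1.rep_smul]
  nlinarith [sq_nonneg (u.rep x * v.rep x)]

/-- The right side is the second derivative of the moment. Its part from differentiating u² is a
moment of 4u²v² ≥ 0 and is dropped; the Hilbert transform part gives the bound. -/
theorem IsFlowLine.moment_inequality {u₀ v₀ : H1} {T a b : ℝ} {γ : ℝ → H1 × H1}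
    (h : IsFlowLine systemField (u₀, v₀) T γ) (hab : a < b) (ha : 0 ≤ a)
    (hb : b ≤ 2 * Real.pi) (hlen : b - a < Real.pi)
    (hsupp : ∀ x ∈ Icc 0 (2 * Real.pi), x ∉ Ioo a b → u₀.rep x = 0) {t : ℝ}
    (ht : t ∈ Ico 0 T) :
    2 * Real.cos ((b - a) / 2) / (Real.pi * (b - a) ^ 2)
        * momentL a b hab.le ((γ t).1.mul (γ t).1) ^ 2
      ≤ 4 * momentL a b hab.le (((γ t).1.mul (γ t).1).mul (hilbertL ((γ t).1.mul (γ t).1))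
        + ((4 : ℝ) • ((γ t).1.mul (γ t).1).mul (γ t).2).mul (γ t).2) := by
  have hz : ∀ x ∈ Icc 0 (2 * Real.pi), x ∉ Ioo a b → ((γ t).1.mul (γ t).1).rep x = 0 := by
    intro x hx hxab
    rw [H1.rep_mul, h.rep_eq_zero (hsupp x hx hxab) ht, mul_zero]
  have h1 := momentL_mul_hilbertL_ge _ hab ha hb hlen (γ t).1.rep_mul_self_nonneg hz
  have h2 := momentL_nonneg hab.le ((γ t).1.rep_sq_mul_sq_nonneg (γ t).2)
  have h3 : 2 * Real.cos ((b - a) / 2) / (Real.pi * (b - a) ^ 2)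
      = 4 * (Real.cos ((b - a) / 2) / (2 * Real.pi * (b - a) ^ 2)) := by
    have := Real.pi_pos
    have hba : b - a ≠ 0 := by linarith
    field_simp
    ring
  rw [map_add, h3, mul_assoc]
  exact mul_le_mul_of_nonneg_left (h1.trans (le_add_of_nonneg_right h2)) (by norm_num)

theorem IsFlowLine.hasDerivAt_momentL {p : H1 × H1} {T a b : ℝ} {γ : ℝ → H1 × H1}
    (h : IsFlowLine systemField p T γ) (hab : a ≤ b) {t : ℝ} (ht : t ∈ Ioo 0 T) :
    HasDerivAt (fun t => momentL a b hab ((γ t).1.mul (γ t).1))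
      (4 * momentL a b hab (((γ t).1.mul (γ t).1).mul (γ t).2)) t := by
  have h1 := (momentL a b hab).hasFDerivAt.comp_hasDerivAt t (h.hasDerivAt_sq ht)
  refine HasDerivAt.congr_deriv h1 ?_
  rw [map_smul, smul_eq_mul]

theorem IsFlowLine.hasDerivAt_momentL_mul {p : H1 × H1} {T a b : ℝ} {γ : ℝ → H1 × H1}
    (h : IsFlowLine systemField p T γ) (hab : a ≤ b) {t : ℝ} (ht : t ∈ Ioo 0 T) :
    HasDerivAt (fun t => 4 * momentL a b hab (((γ t).1.mul (γ t).1).mul (γ t).2))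
      (4 * momentL a b hab (((γ t).1.mul (γ t).1).mul (hilbertL ((γ t).1.mul (γ t).1))
        + ((4 : ℝ) • ((γ t).1.mul (γ t).1).mul (γ t).2).mul (γ t).2)) t :=
  HasDerivAt.const_mul 4
    ((momentL a b hab).hasFDerivAt.comp_hasDerivAt t (h.hasDerivAt_sq_mul ht))

theorem H1.continuousOn_mul {u v : ℝ → H1} {s : Set ℝ} (hu : ContinuousOn u s)
    (hv : ContinuousOn v s) : ContinuousOn (fun t => (u t).mul (v t)) s :=
  Continuous.comp_continuousOn (g := fun p : H1 × H1 => p.1.mul p.2) (f := fun t => (u t, v t))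
    H1.continuous_mul (hu.prodMk hv)

theorem IsFlowLine.continuousOn_sq {p : H1 × H1} {T : ℝ} {γ : ℝ → H1 × H1}
    (h : IsFlowLine systemField p T γ) :
    ContinuousOn (fun t => (γ t).1.mul (γ t).1) (Ico 0 T) :=
  H1.continuousOn_mul (u := fun t => (γ t).1) (v := fun t => (γ t).1)
    (continuous_fst.comp_continuousOn h.continuousOn)
    (continuous_fst.comp_continuousOn h.continuousOn)

theorem IsFlowLine.continuousOn_momentL {p : H1 × H1} {T a b : ℝ} {γ : ℝ → H1 × H1}
    (h : IsFlowLine systemField p T γ) (hab : a ≤ b) :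
    ContinuousOn (fun t => momentL a b hab ((γ t).1.mul (γ t).1)) (Ico 0 T) :=
  Continuous.comp_continuousOn (g := fun F => momentL a b hab F)
    (f := fun t => (γ t).1.mul (γ t).1) (momentL a b hab).continuous h.continuousOn_sq

theorem IsFlowLine.continuousOn_momentL_mul {p : H1 × H1} {T a b : ℝ} {γ : ℝ → H1 × H1}
    (h : IsFlowLine systemField p T γ) (hab : a ≤ b) :
    ContinuousOn (fun t => 4 * momentL a b hab (((γ t).1.mul (γ t).1).mul (γ t).2))
      (Ico 0 T) := by
  have h1 : ContinuousOn (fun t => ((γ t).1.mul (γ t).1).mul (γ t).2) (Ico 0 T) :=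
    H1.continuousOn_mul (u := fun t => (γ t).1.mul (γ t).1) (v := fun t => (γ t).2)
      h.continuousOn_sq (continuous_snd.comp_continuousOn h.continuousOn)
  exact continuousOn_const.mul (Continuous.comp_continuousOn (g := fun F => momentL a b hab F)
    (f := fun t => ((γ t).1.mul (γ t).1).mul (γ t).2) (momentL a b hab).continuous h1)

theorem IsFlowLine.lifespan_le {u₀ v₀ : H1} {T a b : ℝ} {γ : ℝ → H1 × H1}
    (h : IsFlowLine systemField (u₀, v₀) T γ) (hab : a < b) (ha : 0 ≤ a)
    (hb : b ≤ 2 * Real.pi) (hlen : b - a < Real.pi)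
    (hsupp : ∀ x ∈ Icc 0 (2 * Real.pi), x ∉ Ioo a b → u₀.rep x = 0) {C : ℝ} (hC : 0 < C)
    (hC0 : 4 * momentL a b hab.le ((u₀.mul u₀).mul v₀) = C) :
    T ≤ (4 * C * Real.cos ((b - a) / 2) / (3 * Real.pi * (b - a) ^ 2)) ^ (-(1 / 3) : ℝ)
      * ∫ y in Ioi (0 : ℝ), 1 / Real.sqrt (y ^ 3 + 1) := by
  have hpi := Real.pi_pos
  have hba : 0 < b - a := by linarith
  have hcos : 0 < Real.cos ((b - a) / 2) :=
    Real.cos_pos_of_mem_Ioo ⟨by linarith, by linarith⟩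
  have hk0 : 0 < 2 * Real.cos ((b - a) / 2) / (Real.pi * (b - a) ^ 2) := by positivity
  have hkC : 4 * C * Real.cos ((b - a) / 2) / (3 * Real.pi * (b - a) ^ 2)
      = 2 * (2 * Real.cos ((b - a) / 2) / (Real.pi * (b - a) ^ 2)) * C / 3 := by
    field_simp
    ring
  have hg0 : 4 * momentL a b hab.le (((γ 0).1.mul (γ 0).1).mul (γ 0).2) = C := by
    rw [h.init]
    exact hC0
  rw [hkC]
  exact time_le_of_second_order_inequality hk0 hC (h.continuousOn_momentL hab.le)
    (h.continuousOn_momentL_mul hab.le) (fun t ht => h.hasDerivAt_momentL hab.le ht)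
    (fun t ht => h.hasDerivAt_momentL_mul hab.le ht)
    (fun t ht => h.moment_inequality hab ha hb hlen hsupp (Ioo_subset_Ico_self ht))
    (momentL_nonneg hab.le (γ 0).1.rep_mul_self_nonneg) hg0

end NonlocalSystem

theorem mainTheorem3 (a b : ℝ) (hab : a < b)
    (hsub : Set.Ioo a b ⊆ Set.Ioo 0 (2 * Real.pi)) (hlen : b - a < Real.pi)
    (u₀ v₀ : NonlocalSystem.H1)
    (hsupp : ∀ᵐ x : ℝ, x ∈ Set.Ioo 0 (2 * Real.pi) → x ∉ Set.Ioo a b → u₀.fn x = 0)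
    (φ : ℝ → ℝ) (hφper : Function.Periodic φ (2 * Real.pi))
    (hφlip : ∃ K : NNReal, LipschitzWith K φ)
    (hφ : ∀ x ∈ Set.Icc a b, φ x = x - a)
    (C : ℝ) (hC : C = 4 * ∫ x in a..b, φ x * u₀.fn x ^ 2 * v₀.fn x) (hCpos : 0 < C) :
    ∃ T : ℝ, 0 < T ∧
      T ≤ (4 * C * Real.cos ((b - a) / 2) / (3 * Real.pi * (b - a) ^ 2)) ^ (-(1 / 3) : ℝ)
        * (∫ y in Set.Ioi (0 : ℝ), 1 / Real.sqrt (y ^ 3 + 1)) ∧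
      ∃ u v : ℝ → NonlocalSystem.H1,
        NonlocalSystem.IsSolution u₀ v₀ T u v ∧
        Filter.Tendsto (fun t => ‖u t‖ + ‖v t‖) (nhdsWithin T (Set.Iio T)) Filter.atTop ∧
        ∀ (T' : ℝ) (u' v' : ℝ → NonlocalSystem.H1), 0 < T' →
          NonlocalSystem.IsSolution u₀ v₀ T' u' v' →
          T' ≤ T ∧ ∀ t ∈ Set.Ico 0 T', u' t = u t ∧ v' t = v t := by
  obtain ⟨ha, hb⟩ := (Ioo_subset_Ioo_iff hab).1 hsub
  have hz := NonlocalSystem.H1.rep_eq_zero_of_ae hab ha hb hlen hsupp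
  -- On [a, b] the weight φ is x - a, so C is the initial slope of the moment.
  have hC0 : 4 * NonlocalSystem.momentL a b hab.le ((u₀.mul u₀).mul v₀) = C := by
    rw [hC, NonlocalSystem.momentL_apply]
    congr 1
    refine intervalIntegral.integral_congr_ae ?_
    filter_upwards [u₀.fn_ae_rep, v₀.fn_ae_rep] with x h1 h2 hx
    rw [uIoc_of_le hab.le] at hx
    rw [h1, h2, hφ x (Ioc_subset_Icc_self hx), NonlocalSystem.H1.rep_mul,
      NonlocalSystem.H1.rep_mul]
    ring
  obtain ⟨T, hT, hTB, γ, hγ, hblow, huniq⟩ := NonlocalSystem.exists_maximal_isFlowLine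
    NonlocalSystem.lipschitzOnWith_systemField (u₀, v₀)
    (fun T γ _ h => h.lifespan_le hab ha hb hlen hz hCpos hC0)
  refine ⟨T, hT, hTB, fun t => (γ t).1, fun t => (γ t).2, hγ.isSolution, ?_, ?_⟩
  -- The product space carries the maximum norm, which is at most the sum.
  · refine tendsto_atTop_mono (fun t => ?_) hblow
    exact max_le (le_add_of_nonneg_right (norm_nonneg _)) (le_add_of_nonneg_left (norm_nonneg _))
  · intro T' u' v' hT' h'
    obtain ⟨h1, h2⟩ := huniq T' _ hT' (h'.isFlowLine)
    refine ⟨h1, fun t ht => ?_⟩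
    have h3 := h2 t ht
    exact ⟨congrArg Prod.fst h3, congrArg Prod.snd h3⟩
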